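/- Let $\mathbb C^6$ have coordinates $l_{ij}=l_{ji}$ indexed by the six pairs $1\le i<j\le 4$. For a configuration $\mathbf p=(\mathbf p_1,\dots,\mathbf p_4)$ of four points in $\mathbb C^d$ put $m_{ij}(\mathbf p)=\sum_{k=1}^d(\mathbf p_i^k-\mathbf p_j^k)^2$ (no conjugation), and let $$L_{d,4}=\{\,l\in\mathbb C^6:\ \text{there is a configuration } \mathbf p \text{ of four points in } \mathbb C^d \text{ with } l_{ij}^2=m_{ij}(\mathbf p)\text{ for all } i<j\,\}.$$ For a complex affine variety $V$, let $\operatorname{sing}(V)$ be the set of points $x\in V$ at which the dimension of the Zariski tangent space (the kernel of the Jacobian matrix at $x$ of generators of the ideal $I(V)$ of all polynomials vanishing on $V$) differs from the local dimension (the largest dimension of an irreducible component of $V$ through $x$). **Theorem.** The singular locus $\operatorname{sing}(L_{2,4})$ is the union of $60$ distinct $3$-dimensional linear subspaces of $\mathbb C^6$, which are partitioned into the following three types. - Type I: $32$ subspaces, whose union is $L_{1,4}$ (they arise from configurations of four points on a line). They are the subspaces defined by $$l_{12}-s_{13}l_{13}+s_{23}l_{23}=0,\qquad l_{12}-s_{14}l_{14}+s_{24}l_{24}=0,\qquad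 s_{13}l_{13}-s_{14}l_{14}+s_{34}l_{34}=0,$$ with $s_{13},s_{23},s_{14},s_{24},s_{34}\in\{-1,1\}$. - Type II: $24$ subspaces, four for each of the six pairs $i<j$. The four subspaces for $ij$ are those defined by $$l_{ij}=0,\qquad l_{ik}-s_{k}\,l_{jk}=0,\qquad l_{ih}-s_{h}\,l_{jh}=0,$$ where $\{i,j,k,h\}=\{1,2,3,4\}$ and $s_k,s_h\in\{-1,1\}$; their union is the set of $l\in\mathbb C^6$ for which there is a configuration $\mathbf p$ of four points in $\mathbb C^2$ with $\mathbf p_i=\mathbf p_j$ and $l_{ab}^2=m_{ab}(\mathbf p)$ for all $a<b$. - Type III: $4$ subspaces, one for each triple $i<j<k$, defined by $l_{ij}=l_{ik}=l_{jk}=0$. -/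

import Mathlib

noncomputable section

/-! ### Affine varieties in `ℂ^σ`, dimension, singular locus -/

section Varieties

variable {σ : Type*}

/-- A (complex, embedded, affine) variety: the common zero set of finitely many polynomials. -/
def IsVariety (V : Set (σ → ℂ)) : Prop :=
  ∃ S : Finset (MvPolynomial σ ℂ), V = {x | ∀ p ∈ S, MvPolynomial.eval x p = 0}

/-- A nonempty variety that is not the union of two varieties neither of which contains
the other. -/
def IsIrreducibleVariety (V : Set (σ → ℂ)) : Prop :=
  IsVariety V ∧ V.Nonempty ∧
    ∀ V₁ V₂ : Set (σ → ℂ), IsVariety V₁ → IsVariety V₂ → V = V₁ ∪ V₂ → V₁ ⊆ V₂ ∨ V₂ ⊆ V₁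

/-- The components of `V`: its maximal irreducible subvarieties. -/
def IsVarietyComponent (V Z : Set (σ → ℂ)) : Prop :=
  Maximal (fun W => IsIrreducibleVariety W ∧ W ⊆ V) Z

/-- The dimension of a variety: the Krull dimension of its coordinate ring `ℂ[x] / I(V)`. -/
def varietyDim (V : Set (σ → ℂ)) : WithBot ℕ∞ :=
  ringKrullDim (MvPolynomial σ ℂ ⧸ MvPolynomial.vanishingIdeal ℂ V)

/-- The local dimension of `V` at `x`: the largest dimension of a component of `V` through `x`. -/
def localDim (V : Set (σ → ℂ)) (x : σ → ℂ) : WithBot ℕ∞ :=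
  ⨆ Z ∈ {Z : Set (σ → ℂ) | IsVarietyComponent V Z ∧ x ∈ Z}, varietyDim Z

variable [Fintype σ]

/-- The Zariski tangent space of `V` at `x`: the vectors annihilated by the gradients at `x` of
all polynomials in `I(V)`. (For `x ∈ V` this is the kernel of the Jacobian matrix at `x` of any
generating set of `I(V)`.) -/
def zariskiTangentSpace (V : Set (σ → ℂ)) (x : σ → ℂ) : Submodule ℂ (σ → ℂ) where
  carrier := {v | ∀ p ∈ MvPolynomial.vanishingIdeal ℂ V,
    ∑ i, MvPolynomial.eval x (MvPolynomial.pderiv i p) * v i = 0}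
  zero_mem' := by intro p _; simp
  add_mem' := by
    intro v w hv hw p hp
    simp only [Pi.add_apply, mul_add, Finset.sum_add_distrib, hv p hp, hw p hp, add_zero]
  smul_mem' := by
    intro c v hv p hp
    have h := hv p hp
    simp only [Pi.smul_apply, smul_eq_mul, mul_left_comm _ c, ← Finset.mul_sum, h, mul_zero]

/-- The singular locus of `V`: the points of `V` at which the dimension of the Zariski tangent
space differs from the local dimension. -/
def singularLocus (V : Set (σ → ℂ)) : Set (σ → ℂ) :=
  {x | x ∈ V ∧ (Module.finrank ℂ (zariskiTangentSpace V x) : WithBot ℕ∞) ≠ localDim V x}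

end Varieties

/-! ### Measurement varieties -/

/-- The edges `ij`, `i < j`, of the complete graph on `n` vertices. -/
abbrev Edge (n : ℕ) : Type := {e : Fin n × Fin n // e.1 < e.2}

/-- The vector of complex squared lengths `m_{ij}(p) = ∑ₖ (pᵢᵏ - pⱼᵏ)²` (no conjugation) of a
configuration `p` of `n` points in `ℂ^d`. -/
def sqLengths {d n : ℕ} (p : Fin n → Fin d → ℂ) : Edge n → ℂ :=
  fun e => ∑ k, (p e.1.1 k - p e.1.2 k) ^ 2

/-- The squared measurement variety `M_{d,n}`. -/
def squaredMeasurementVariety (d n : ℕ) : Set (Edge n → ℂ) :=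
  Set.range (sqLengths (d := d) (n := n))

/-- The squaring map, acting coordinatewise. -/
def squaringMap {n : ℕ} (l : Edge n → ℂ) : Edge n → ℂ := fun e => l e ^ 2

/-- The unsquared measurement variety `L_{d,n}`. -/
def unsquaredMeasurementVariety (d n : ℕ) : Set (Edge n → ℂ) :=
  squaringMap ⁻¹' squaredMeasurementVariety d n

/-- The coordinate `l_{ij} = l_{ji}` of `l` at the unordered pair of distinct vertices `i, j`
(and `0` if `i = j`), as a linear functional of `l`. -/
def len {n : ℕ} (i j : Fin n) : (Edge n → ℂ) →ₗ[ℂ] ℂ :=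
  if h : i < j then LinearMap.proj (⟨(i, j), h⟩ : Edge n)
  else if h : j < i then LinearMap.proj (⟨(j, i), h⟩ : Edge n)
  else 0

/-! ### The three types of subspaces of `ℂ^6`

The vertices `1, 2, 3, 4` are written `0, 1, 2, 3 : Fin 4`. Signs are elements of `ℤˣ = {1, -1}`.
-/

/-- The subspace `l₁₂ - s₁₃ l₁₃ + s₂₃ l₂₃ = 0`, `l₁₂ - s₁₄ l₁₄ + s₂₄ l₂₄ = 0`,
`s₁₃ l₁₃ - s₁₄ l₁₄ + s₃₄ l₃₄ = 0`. -/
def subspaceI (s₁₃ s₂₃ s₁₄ s₂₄ s₃₄ : ℤˣ) : Submodule ℂ (Edge 4 → ℂ) :=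
  LinearMap.ker (len 0 1 - s₁₃ • len 0 2 + s₂₃ • len 1 2) ⊓
  LinearMap.ker (len 0 1 - s₁₄ • len 0 3 + s₂₄ • len 1 3) ⊓
  LinearMap.ker (s₁₃ • len 0 2 - s₁₄ • len 0 3 + s₃₄ • len 2 3)

/-- The subspaces of type I. -/
def typeI : Set (Submodule ℂ (Edge 4 → ℂ)) :=
  {W | ∃ s₁₃ s₂₃ s₁₄ s₂₄ s₃₄ : ℤˣ, W = subspaceI s₁₃ s₂₃ s₁₄ s₂₄ s₃₄}

/-- The subspace `l_{ij} = 0`, `l_{ik} = sₖ l_{jk}` for the two vertices `k` other than `i, j`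
(the values of `s` at `i` and `j` are not used). -/
def subspaceII (i j : Fin 4) (s : Fin 4 → ℤˣ) : Submodule ℂ (Edge 4 → ℂ) :=
  LinearMap.ker (len i j) ⊓
  ⨅ k ∈ {k : Fin 4 | k ≠ i ∧ k ≠ j}, LinearMap.ker (len i k - s k • len j k)

/-- The subspaces of type II coming from collapsing the edge `ij`. -/
def typeIIAt (i j : Fin 4) : Set (Submodule ℂ (Edge 4 → ℂ)) :=
  {W | ∃ s : Fin 4 → ℤˣ, W = subspaceII i j s}

/-- The subspaces of type II. -/
def typeII : Set (Submodule ℂ (Edge 4 → ℂ)) :=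
  {W | ∃ i j : Fin 4, i < j ∧ W ∈ typeIIAt i j}

/-- The subspace `l_{ij} = l_{ik} = l_{jk} = 0`. -/
def subspaceIII (i j k : Fin 4) : Submodule ℂ (Edge 4 → ℂ) :=
  LinearMap.ker (len i j) ⊓ LinearMap.ker (len i k) ⊓ LinearMap.ker (len j k)

/-- The subspaces of type III. -/
def typeIII : Set (Submodule ℂ (Edge 4 → ℂ)) :=
  {W | ∃ i j k : Fin 4, i < j ∧ j < k ∧ W = subspaceIII i j k}

end

/-!
`L_{2,4}` is the hypersurface where the Cayley–Menger determinant of a tetrahedron, as a polynomial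
in the lengths, vanishes. This polynomial is irreducible by Eisenstein's criterion at a suitable
point, so by the Jacobian criterion the singular points are its critical points.

By Jacobi's formula the gradient is a trace against the adjugate of the based Gram matrix. On
`L_{2,4}`, either the adjugate vanishes, i.e. the Gram matrix has rank at most one and `l` is
realized on a line (type I), or it is `c • w wᵀ` with `c ≠ 0` and `w` spanning the affine
dependencies, and the partial derivative in `l_{ij}` is a nonzero multiple of `l_{ij} wᵢ wⱼ`. In
the second case a critical point is one where all lengths within the support of `w` vanish. A
support `{i, j}` means that `l_{ij} = 0` and the lengths from `i` and from `j` agree up to signs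
(type II); a larger support contains a triangle of zero lengths (type III), and conversely such a
triangle always carries an affine dependency.

Each subspace projects isomorphically to the three lengths at a vertex or on a face, so it has
dimension three and a point with prescribed zero lengths, which distinguishes the subspaces.
-/

open Matrix MvPolynomial

section AffineSpace

variable {R k σ : Type*} [CommRing R] [Field k]

/-- The automorphism `X i ↦ X i + c i` of a polynomial ring, by which the maximal ideals of any
two points are conjugate. -/
noncomputable def translateEquiv (c : σ → R) : MvPolynomial σ R ≃ₐ[R] MvPolynomial σ R :=
  AlgEquiv.ofAlgHom (aeval fun i => X i + C (c i)) (aeval fun i => X i - C (c i))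
    (by ext i : 1; simp [algHom_C]) (by ext i : 1; simp [algHom_C])

lemma aeval_translateEquiv (c x : σ → R) (p : MvPolynomial σ R) :
    aeval x (translateEquiv c p) = aeval (x + c) p := by
  have h : (aeval x).comp (translateEquiv c : MvPolynomial σ R →ₐ[R] MvPolynomial σ R) =
      aeval (R := R) (x + c) := by
    ext i
    simp [translateEquiv]
  exact DFunLike.congr_fun h p

lemma height_vanishingIdeal_singleton_eq (a b : σ → k) :
    (vanishingIdeal k {a}).height = (vanishingIdeal k {b}).height := by
  rw [← RingEquiv.height_comap (translateEquiv (a - b)).toRingEquiv (vanishingIdeal k {b})]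
  congr 1
  ext p
  have h := aeval_translateEquiv (a - b) b p
  rw [add_sub_cancel] at h
  rw [Ideal.mem_comap, mem_vanishingIdeal_singleton_iff, mem_vanishingIdeal_singleton_iff, ← h]
  rfl

lemma height_vanishingIdeal_singleton [IsAlgClosed k] [Finite σ] (a : σ → k) :
    ((vanishingIdeal k {a}).height : WithBot ℕ∞) = ringKrullDim (MvPolynomial σ k) := by
  rw [← Ideal.sup_isMaximal_height_eq_ringKrullDim, WithBot.coe_inj]
  apply le_antisymm
  · exact le_iSup₂_of_le (f := fun (I : Ideal (MvPolynomial σ k)) (_ : I.IsMaximal) => I.height)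
      (vanishingIdeal k {a}) (isMaximal_iff_eq_vanishingIdeal_singleton.2 ⟨a, rfl⟩) le_rfl
  · refine iSup₂_le fun I hI => ?_
    obtain ⟨b, rfl⟩ := isMaximal_iff_eq_vanishingIdeal_singleton.1 hI
    exact (height_vanishingIdeal_singleton_eq b a).le

end AffineSpace

section IrreducibleVarieties

variable {σ : Type*} {V Z : Set (σ → ℂ)}

lemma zeroLocus_vanishingIdeal_of_isVariety (hV : IsVariety V) :
    zeroLocus ℂ (vanishingIdeal ℂ V) = V := by
  refine subset_antisymm ?_ (zeroLocus_vanishingIdeal_le V)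
  obtain ⟨S, rfl⟩ := hV
  intro x hx p hp
  rw [← aeval_eq_eval]
  exact hx p fun y hy => by rw [aeval_eq_eval]; exact hy p hp

lemma isIrreducibleVariety_of_isPrime_vanishingIdeal (hV : IsVariety V)
    (hprime : (vanishingIdeal ℂ V).IsPrime) : IsIrreducibleVariety V := by
  refine ⟨hV, Set.nonempty_iff_ne_empty.2 fun h => hprime.ne_top ?_, fun V₁ V₂ hV₁ hV₂ h => ?_⟩
  · rw [h, vanishingIdeal_empty]
  have hle : vanishingIdeal ℂ V₁ ⊓ vanishingIdeal ℂ V₂ ≤ vanishingIdeal ℂ V := by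
    rw [h]
    rintro p ⟨hp₁, hp₂⟩ x (hx | hx)
    exacts [hp₁ x hx, hp₂ x hx]
  have hsub {W : Set (σ → ℂ)} (hW : IsVariety W)
      (hWV : vanishingIdeal ℂ W ≤ vanishingIdeal ℂ V) : V ⊆ W := by
    rw [← zeroLocus_vanishingIdeal_of_isVariety hV, ← zeroLocus_vanishingIdeal_of_isVariety hW]
    exact zeroLocus_anti_mono hWV
  rcases hprime.inf_le.1 hle with h₁ | h₂
  · exact Or.inr ((h ▸ Set.subset_union_right).trans (hsub hV₁ h₁))
  · exact Or.inl ((h ▸ Set.subset_union_left).trans (hsub hV₂ h₂))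

lemma isVarietyComponent_iff_eq (hV : IsIrreducibleVariety V) : IsVarietyComponent V Z ↔ Z = V := by
  constructor
  · intro h
    exact subset_antisymm h.1.2 (h.2 ⟨hV, subset_rfl⟩ h.1.2)
  · rintro rfl
    exact ⟨⟨hV, subset_rfl⟩, fun W hW _ => hW.2⟩

lemma localDim_eq_varietyDim (hV : IsIrreducibleVariety V) {x : σ → ℂ} (hx : x ∈ V) :
    localDim V x = varietyDim V := by
  have hZ : {Z : Set (σ → ℂ) | IsVarietyComponent V Z ∧ x ∈ Z} = {V} := by
    ext Z
    rw [Set.mem_ofPred_eq, isVarietyComponent_iff_eq hV, Set.mem_singleton_iff]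
    exact and_iff_left_of_imp fun h => h ▸ hx
  rw [localDim, hZ, iSup_singleton]

end IrreducibleVarieties

section Hypersurface

variable {σ : Type*} {f : MvPolynomial σ ℂ}

lemma isVariety_hypersurface (f : MvPolynomial σ ℂ) : IsVariety {x | eval x f = 0} :=
  ⟨{f}, by simp⟩

variable [Finite σ]

lemma vanishingIdeal_hypersurface (hf : Irreducible f) :
    vanishingIdeal ℂ {x | eval x f = 0} = Ideal.span {f} := by
  have hprime : (Ideal.span {f}).IsPrime := (Ideal.span_singleton_prime hf.ne_zero).2 hf.prime
  have hzero : {x | eval x f = 0} = zeroLocus ℂ (Ideal.span {f}) := by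
    ext x
    simp [zeroLocus_span, aeval_eq_eval]
  rw [hzero, IsPrime.vanishingIdeal_zeroLocus]

lemma isIrreducibleVariety_hypersurface (hf : Irreducible f) :
    IsIrreducibleVariety {x | eval x f = 0} := by
  apply isIrreducibleVariety_of_isPrime_vanishingIdeal (isVariety_hypersurface f)
  rw [vanishingIdeal_hypersurface hf]
  exact (Ideal.span_singleton_prime hf.ne_zero).2 hf.prime

end Hypersurface

section JacobianCriterion

variable {σ : Type*} [Fintype σ] {f : MvPolynomial σ ℂ}

lemma varietyDim_hypersurface_add_one (hf : Irreducible f) :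
    varietyDim {x | eval x f = 0} + 1 = (Fintype.card σ : WithBot ℕ∞) := by
  obtain ⟨a, ha⟩ := (isIrreducibleVariety_hypersurface hf).2.1
  have hmax : (vanishingIdeal ℂ {a}).IsMaximal :=
    isMaximal_iff_eq_vanishingIdeal_singleton.2 ⟨a, rfl⟩
  have hprime := hmax.isPrime
  rw [varietyDim, vanishingIdeal_hypersurface hf,
    Module.ringKrullDim_quotient_add_one_of_mem_nonZeroDivisors
      (mem_nonZeroDivisors_of_ne_zero hf.ne_zero) (height_vanishingIdeal_singleton a)
      (by simpa [aeval_eq_eval] using ha)]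
  simp

/-- The gradient of `f` at `x`, as the linear functional `v ↦ ∇f(x) · v` (no conjugation). -/
noncomputable def gradientFunctional (f : MvPolynomial σ ℂ) (x : σ → ℂ) : (σ → ℂ) →ₗ[ℂ] ℂ :=
  Fintype.linearCombination ℂ fun i => eval x (pderiv i f)

lemma gradientFunctional_apply (f : MvPolynomial σ ℂ) (x v : σ → ℂ) :
    gradientFunctional f x v = ∑ i, eval x (pderiv i f) * v i := by
  simp only [gradientFunctional, Fintype.linearCombination_apply, smul_eq_mul, mul_comm]

lemma gradientFunctional_eq_zero_iff {x : σ → ℂ} :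
    gradientFunctional f x = 0 ↔ ∀ i, eval x (pderiv i f) = 0 := by
  classical
  refine ⟨fun h i => ?_, fun h => LinearMap.ext fun v => ?_⟩
  · simpa [h, Pi.single_apply] using (gradientFunctional_apply f x (Pi.single i 1)).symm
  · simp [gradientFunctional_apply, h]

lemma zariskiTangentSpace_hypersurface (hf : Irreducible f) {x : σ → ℂ} (hx : eval x f = 0) :
    zariskiTangentSpace {x | eval x f = 0} x = LinearMap.ker (gradientFunctional f x) := by
  ext v
  rw [LinearMap.mem_ker, gradientFunctional_apply]
  change (∀ p ∈ vanishingIdeal ℂ {x | eval x f = 0}, _) ↔ _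
  rw [vanishingIdeal_hypersurface hf]
  constructor
  · intro h
    exact h f (Ideal.mem_span_singleton_self f)
  · intro h p hp
    obtain ⟨q, rfl⟩ := Ideal.mem_span_singleton.1 hp
    simp only [pderiv_mul, map_add, map_mul, hx, zero_mul, add_zero, mul_right_comm _ (eval x q),
      ← Finset.sum_mul, h]

lemma finrank_ker_add_one_eq_iff {K E : Type*} [Field K] [AddCommGroup E] [Module K E]
    [FiniteDimensional K E] {φ : Module.Dual K E} :
    Module.finrank K (LinearMap.ker φ) + 1 = Module.finrank K E ↔ φ ≠ 0 := by
  refine ⟨?_, fun h => Module.Dual.finrank_ker_add_one_of_ne_zero h⟩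
  rintro h rfl
  rw [LinearMap.ker_zero, finrank_top] at h
  lia

theorem singularLocus_hypersurface (hf : Irreducible f) :
    singularLocus {x | eval x f = 0} =
      {x | eval x f = 0 ∧ ∀ i, eval x (pderiv i f) = 0} := by
  ext x
  refine and_congr_right fun hx => ?_
  rw [localDim_eq_varietyDim (isIrreducibleVariety_hypersurface hf) hx,
    zariskiTangentSpace_hypersurface hf hx, ← gradientFunctional_eq_zero_iff, Ne, not_iff_comm,
    ← Ne, ← finrank_ker_add_one_eq_iff, Module.finrank_fintype_fun_eq_card,
    ← ENat.WithBot.add_one_cancel, varietyDim_hypersurface_add_one hf]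
  norm_cast

end JacobianCriterion

section DeterminantDerivative

variable {R A ι : Type*} [CommRing R] [CommRing A] [Algebra R A]

lemma derivation_prod [DecidableEq ι] (D : Derivation R A A) (s : Finset ι) (f : ι → A) :
    D (∏ i ∈ s, f i) = ∑ i ∈ s, (∏ j ∈ s.erase i, f j) * D (f i) := by
  induction s using Finset.induction_on with
  | empty => simp
  | insert a s ha ih =>
    rw [Finset.prod_insert ha, Finset.sum_insert ha, Finset.erase_insert ha, D.leibniz, ih,
      add_comm, smul_eq_mul, smul_eq_mul, Finset.mul_sum]
    congr 1
    refine Finset.sum_congr rfl fun i hi => ?_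
    have hai : a ≠ i := fun h => ha (h ▸ hi)
    rw [Finset.erase_insert_of_ne hai, Finset.prod_insert fun h => ha (Finset.mem_of_mem_erase h),
      mul_assoc]

variable [Fintype ι] [DecidableEq ι]

lemma derivation_det (D : Derivation R A A) (M : Matrix ι ι A) :
    D M.det = (M.adjugate * M.map D).trace := by
  have hcol (i : ι) : (M.adjugate * M.map D) i i =
      ∑ τ : Equiv.Perm ι, (τ.sign : A) *
        ((∏ j ∈ Finset.univ.erase i, M (τ j) j) * D (M (τ i) i)) := by
    calc (M.adjugate * M.map D) i i = (M.updateCol i fun k => D (M k i)).det := by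
          rw [← cramer_apply, cramer_eq_adjugate_mulVec]; rfl
      _ = _ := by
          rw [det_apply']
          refine Finset.sum_congr rfl fun τ _ => ?_
          rw [← Finset.prod_erase_mul _ _ (Finset.mem_univ i), updateCol_self]
          congr 2
          exact Finset.prod_congr rfl fun j hj => updateCol_ne (Finset.ne_of_mem_erase hj)
  simp only [trace, diag_apply, hcol]
  rw [Finset.sum_comm, det_apply', map_sum]
  refine Finset.sum_congr rfl fun τ _ => ?_
  rw [← Finset.mul_sum, ← derivation_prod, D.leibniz, D.map_intCast, smul_zero, add_zero,
    smul_eq_mul]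

end DeterminantDerivative

section Adjugate

variable {K m n : Type*} [Field K] [Fintype n]

lemma exists_smul_eq_of_mulVec_eq_zero {A : Matrix m n K} (hA : Fintype.card n ≤ A.rank + 1)
    {u v : n → K} (hu : A *ᵥ u = 0) (hv : A *ᵥ v = 0) (hv₀ : v ≠ 0) : ∃ c : K, u = c • v := by
  let v' : LinearMap.ker A.mulVecLin := ⟨v, hv⟩
  have hv' : v' ≠ 0 := fun h => hv₀ (Subtype.ext_iff.1 h)
  have hker : Module.finrank K (LinearMap.ker A.mulVecLin) = 1 := by
    have hpos := Module.finrank_pos_iff_exists_ne_zero (R := K).2 ⟨v', hv'⟩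
    have hrank := LinearMap.finrank_range_add_finrank_ker A.mulVecLin
    rw [Module.finrank_fintype_fun_eq_card] at hrank
    unfold rank at hA
    lia
  obtain ⟨c, hc⟩ := exists_smul_eq_of_finrank_eq_one hker hv' ⟨u, hu⟩
  exact ⟨c, (Subtype.ext_iff.1 hc).symm⟩

lemma exists_mulVec_eq_zero_of_rank_add_one_lt {A : Matrix m n K}
    (hA : A.rank + 1 < Fintype.card n) (i : n) : ∃ u ≠ 0, A *ᵥ u = 0 ∧ u i = 0 := by
  let φ : LinearMap.ker A.mulVecLin →ₗ[K] K := LinearMap.proj i ∘ₗ Submodule.subtype _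
  have hrank := LinearMap.finrank_range_add_finrank_ker A.mulVecLin
  rw [Module.finrank_fintype_fun_eq_card] at hrank
  have hlt : Module.finrank K K < Module.finrank K (LinearMap.ker A.mulVecLin) := by
    rw [Module.finrank_self]
    unfold rank at hA
    lia
  obtain ⟨u, hu, hu₀⟩ := Submodule.exists_mem_ne_zero_of_ne_bot
    (LinearMap.ker_ne_bot_of_finrank_lt (f := φ) hlt)
  exact ⟨u, fun h => hu₀ (Subtype.ext h), u.2, hu⟩

variable [DecidableEq n]

lemma det_eq_zero_iff_rank_lt_card {A : Matrix n n K} : A.det = 0 ↔ A.rank < Fintype.card n := by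
  refine ⟨fun h => ?_, fun h => not_not.1 fun hdet => h.ne (rank_of_det_ne_zero hdet)⟩
  obtain ⟨v, hv₀, hv⟩ := exists_mulVec_eq_zero_iff.2 h
  have hker : LinearMap.ker A.mulVecLin ≠ ⊥ := (Submodule.ne_bot_iff _).2 ⟨v, hv, hv₀⟩
  have hrank := LinearMap.finrank_range_add_finrank_ker A.mulVecLin
  rw [Module.finrank_fintype_fun_eq_card] at hrank
  have := Submodule.one_le_finrank_iff.2 hker
  unfold rank
  lia

lemma det_eq_zero_of_adjugate_eq_zero [Nonempty n] {A : Matrix n n K} (hA : A.adjugate = 0) :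
    A.det = 0 := by
  obtain ⟨i⟩ := ‹Nonempty n›
  simpa [hA] using (congrFun₂ (mul_adjugate A) i i).symm

lemma adjugate_apply_eq_zero_iff {A : Matrix n n K} {i j : n} :
    A.adjugate i j = 0 ↔ ∃ u ≠ 0, u i = 0 ∧ ∀ k ≠ j, (A *ᵥ u) k = 0 := by
  rw [adjugate_apply, ← exists_mulVec_eq_zero_iff]
  refine exists_congr fun u => and_congr_right fun _ => ?_
  rw [updateRow_mulVec, single_one_dotProduct, funext_iff]
  constructor
  · intro h
    exact ⟨by simpa using h j, fun k hk => by simpa [hk] using h k⟩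
  · rintro ⟨hi, hk⟩ k
    rcases eq_or_ne k j with rfl | hkj
    · rw [Function.update_self, hi, Pi.zero_apply]
    · rw [Function.update_of_ne hkj, hk k hkj, Pi.zero_apply]

lemma adjugate_eq_zero_of_rank_add_one_lt {A : Matrix n n K}
    (hA : A.rank + 1 < Fintype.card n) : A.adjugate = 0 := by
  ext i j
  obtain ⟨u, hu₀, hu, hui⟩ := exists_mulVec_eq_zero_of_rank_add_one_lt hA i
  exact adjugate_apply_eq_zero_iff.2 ⟨u, hu₀, hui, fun k _ => congr_fun hu k⟩

lemma adjugate_ne_zero_of_card_le_rank_add_one [Nonempty n] {A : Matrix n n K}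
    (hA : Fintype.card n ≤ A.rank + 1) : A.adjugate ≠ 0 := by
  intro hadj
  have hdet := det_eq_zero_of_adjugate_eq_zero hadj
  obtain ⟨v, hv₀, hv⟩ := exists_mulVec_eq_zero_iff.2 hdet
  obtain ⟨w, hw₀, hw⟩ := exists_vecMul_eq_zero_iff.2 hdet
  obtain ⟨i, hvi⟩ := Function.ne_iff.1 hv₀
  obtain ⟨j, hwj⟩ := Function.ne_iff.1 hw₀
  obtain ⟨u, hu₀, hui, hu⟩ := adjugate_apply_eq_zero_iff.1 (congrFun₂ hadj i j)
  have huj : w j * (A *ᵥ u) j = 0 :=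
    calc w j * (A *ᵥ u) j = w ⬝ᵥ A *ᵥ u :=
          (Fintype.sum_eq_single (f := fun k => w k * (A *ᵥ u) k) j
            fun k hk => by rw [hu k hk, mul_zero]).symm
      _ = 0 := by rw [dotProduct_mulVec, hw, zero_dotProduct]
  have hAu : A *ᵥ u = 0 := by
    ext k
    rcases eq_or_ne k j with rfl | hkj
    · exact (mul_eq_zero.1 huj).resolve_left hwj
    · exact hu k hkj
  obtain ⟨c, rfl⟩ := exists_smul_eq_of_mulVec_eq_zero hA hAu hv hv₀
  have hc : c = 0 := (mul_eq_zero.1 hui).resolve_right hvi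
  exact hu₀ (by rw [hc, zero_smul])

lemma adjugate_eq_zero_iff_rank_add_one_lt [Nonempty n] {A : Matrix n n K} :
    A.adjugate = 0 ↔ A.rank + 1 < Fintype.card n :=
  ⟨fun h => not_le.1 fun hA => adjugate_ne_zero_of_card_le_rank_add_one hA h,
    adjugate_eq_zero_of_rank_add_one_lt⟩

lemma exists_adjugate_eq_smul_vecMulVec {A : Matrix n n K} (hA : A.IsSymm) {v : n → K}
    (hv : A *ᵥ v = 0) (hv₀ : v ≠ 0) : ∃ c : K, A.adjugate = c • vecMulVec v v := by
  rcases le_or_gt (Fintype.card n) (A.rank + 1) with hrank | hrank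
  · have hdet : A.det = 0 := exists_mulVec_eq_zero_iff.1 ⟨v, hv₀, hv⟩
    have hcol (j : n) : A *ᵥ A.adjugate.col j = 0 := by
      ext i
      have := congrFun₂ (mul_adjugate A) i j
      rwa [hdet, zero_smul] at this
    choose b hb using fun j => exists_smul_eq_of_mulVec_eq_zero hrank (hcol j) hv hv₀
    have hentry (i j : n) : A.adjugate i j = b j * v i := congr_fun (hb j) i
    obtain ⟨k, hvk⟩ := Function.ne_iff.1 hv₀
    refine ⟨b k / v k, ?_⟩
    ext i j
    have hsymm : b j * v k = b k * v j := by
      rw [← hentry, ← hentry, ← transpose_apply A.adjugate, hA.adjugate.eq]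
    rw [hentry, Matrix.smul_apply, vecMulVec_apply, smul_eq_mul, (eq_div_iff hvk).2 hsymm]
    ring
  · exact ⟨0, by rw [adjugate_eq_zero_of_rank_add_one_lt hrank, zero_smul]⟩

end Adjugate

section SymmetricFactorization

variable {K m n : Type*} [Field K] [Fintype n]

/-- Wedderburn's rank reduction: the subtracted rank-one matrix puts `x` into the kernel. -/
lemma rank_sub_vecMulVec_lt [Fintype m] (A : Matrix m n K) {x : n → K} {z : m → K}
    (hzx : z ⬝ᵥ A *ᵥ x ≠ 0) :
    (A - (z ⬝ᵥ A *ᵥ x)⁻¹ • vecMulVec (A *ᵥ x) (z ᵥ* A)).rank < A.rank := by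
  set B := A - (z ⬝ᵥ A *ᵥ x)⁻¹ • vecMulVec (A *ᵥ x) (z ᵥ* A) with hB
  have hmul (u : n → K) : B *ᵥ u = A *ᵥ u - ((z ⬝ᵥ A *ᵥ x)⁻¹ * (z ⬝ᵥ A *ᵥ u)) • A *ᵥ x := by
    rw [hB, sub_mulVec, smul_mulVec, vecMulVec_mulVec, ← dotProduct_mulVec, op_smul_eq_smul,
      smul_smul]
  have hker : LinearMap.ker A.mulVecLin < LinearMap.ker B.mulVecLin := by
    refine SetLike.lt_iff_le_and_exists.2 ⟨fun u hu => ?_, x, ?_, fun hx => hzx ?_⟩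
    · have hAu : A *ᵥ u = 0 := hu
      rw [LinearMap.mem_ker, mulVecLin_apply, hmul, hAu, dotProduct_zero, mul_zero, zero_smul,
        sub_zero]
    · rw [LinearMap.mem_ker, mulVecLin_apply, hmul, inv_mul_cancel₀ hzx, one_smul, sub_self]
    · rw [show A *ᵥ x = 0 from hx, dotProduct_zero]
  have hlt := Submodule.finrank_lt_finrank_of_lt hker
  have hA := LinearMap.finrank_range_add_finrank_ker A.mulVecLin
  have hB := LinearMap.finrank_range_add_finrank_ker B.mulVecLin
  unfold rank
  lia

lemma exists_dotProduct_mulVec_self_ne_zero [NeZero (2 : K)] {A : Matrix n n K}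
    (hA : A.IsSymm) (hA₀ : A ≠ 0) : ∃ x, x ⬝ᵥ A *ᵥ x ≠ 0 := by
  classical
  have := invertibleOfNonzero (two_ne_zero (α := K))
  have hsymm : LinearMap.IsSymm (toBilin' A) := ⟨fun x y => by
    rw [RingHom.id_apply, toBilin'_apply', toBilin'_apply', dotProduct_mulVec, dotProduct_comm,
      ← mulVec_transpose, hA.eq]⟩
  obtain ⟨x, hx⟩ := LinearMap.BilinForm.exists_bilinForm_self_ne_zero
    ((map_ne_zero_iff _ toBilin'.injective).2 hA₀) hsymm
  exact ⟨x, by rwa [toBilin'_apply'] at hx⟩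

lemma exists_mul_transpose_eq_of_rank_le [IsAlgClosed K] [NeZero (2 : K)] {A : Matrix n n K}
    (hA : A.IsSymm) {d : ℕ} (hd : A.rank ≤ d) : ∃ P : Matrix n (Fin d) K, P * Pᵀ = A := by
  induction d generalizing A with
  | zero =>
    refine ⟨0, ?_⟩
    by_contra hA₀
    obtain ⟨x, hx⟩ :=
      exists_dotProduct_mulVec_self_ne_zero hA fun h => hA₀ (by rw [h, Matrix.zero_mul])
    have hlt := rank_sub_vecMulVec_lt A hx
    lia
  | succ d ih =>
    by_cases hA₀ : A = 0
    · exact ⟨0, by rw [hA₀, Matrix.zero_mul]⟩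
    obtain ⟨x, hx⟩ := exists_dotProduct_mulVec_self_ne_zero hA hA₀
    obtain ⟨r, hr⟩ := IsAlgClosed.exists_pow_nat_eq (x ⬝ᵥ A *ᵥ x)⁻¹ two_pos
    have hlt := rank_sub_vecMulVec_lt A hx
    have hxA : x ᵥ* A = A *ᵥ x := by rw [← mulVec_transpose, hA.eq]
    rw [hxA] at hlt
    obtain ⟨P, hP⟩ := ih (hA.sub (IsSymm.smul (transpose_vecMulVec _ _) _))
      (Nat.le_of_lt_succ (hlt.trans_le hd))
    refine ⟨of fun i => Fin.cons (r * (A *ᵥ x) i) (P i), ?_⟩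
    ext i j
    have hij := congrFun₂ hP i j
    rw [mul_apply, Matrix.sub_apply, Matrix.smul_apply, vecMulVec_apply, ← hr] at hij
    rw [mul_apply, Fin.sum_univ_succ]
    simp only [of_apply, transpose_apply, Fin.cons_zero, Fin.cons_succ] at hij ⊢
    rw [hij, smul_eq_mul]
    ring

end SymmetricFactorization

section BasedGram

variable {R : Type*} {n : ℕ}

/-- The Gram matrix based at the point `p₀`: if `m` consists of the squared distances of points
`p₀, …, pₙ`, this is twice the Gram matrix of the vectors `pᵢ - p₀`, by polarization. The term
`m 0 0`, zero in that case, makes `basedGram_mulVec_tail` hold for every matrix. -/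
def basedGram [AddCommGroup R] (m : Matrix (Fin (n + 1)) (Fin (n + 1)) R) :
    Matrix (Fin n) (Fin n) R :=
  of fun i j => m i.succ 0 + m 0 j.succ - m i.succ j.succ - m 0 0

lemma isSymm_basedGram [AddCommGroup R] {m : Matrix (Fin (n + 1)) (Fin (n + 1)) R}
    (hm : m.IsSymm) : (basedGram m).IsSymm :=
  IsSymm.ext fun i j => by
    simp only [basedGram, of_apply]
    rw [hm.apply i.succ 0, hm.apply 0 j.succ, hm.apply i.succ j.succ,
      add_comm (m i.succ 0)]

lemma map_basedGram {S F : Type*} [AddCommGroup R] [AddCommGroup S] [FunLike F R S]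
    [AddMonoidHomClass F R S] (f : F) (m : Matrix (Fin (n + 1)) (Fin (n + 1)) R) :
    (basedGram m).map f = basedGram (m.map f) := by
  ext i j
  simp [basedGram]

variable [CommRing R] {m : Matrix (Fin (n + 1)) (Fin (n + 1)) R} {u w : Fin (n + 1) → R}

lemma basedGram_mulVec_tail (hw : ∑ i, w i = 0) (i : Fin n) :
    (basedGram m *ᵥ Fin.tail w) i = (m *ᵥ w) 0 - (m *ᵥ w) i.succ := by
  have htail : ∑ j : Fin n, w j.succ = -w 0 := by
    rw [Fin.sum_univ_succ] at hw
    linear_combination hw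
  calc (basedGram m *ᵥ Fin.tail w) i
      = (m i.succ 0 - m 0 0) * ∑ j : Fin n, w j.succ
          + ((∑ j : Fin n, m 0 j.succ * w j.succ) - ∑ j : Fin n, m i.succ j.succ * w j.succ) := by
        rw [mulVec, dotProduct, Finset.mul_sum, ← Finset.sum_sub_distrib, ← Finset.sum_add_distrib]
        refine Finset.sum_congr rfl fun j _ => ?_
        simp only [basedGram, of_apply, Fin.tail]
        ring
    _ = (m *ᵥ w) 0 - (m *ᵥ w) i.succ := by
        simp only [mulVec, dotProduct, Fin.sum_univ_succ, htail]
        ring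

lemma tail_dotProduct_basedGram_mulVec_tail (hu : ∑ i, u i = 0) (hw : ∑ i, w i = 0) :
    Fin.tail u ⬝ᵥ basedGram m *ᵥ Fin.tail w = -(u ⬝ᵥ m *ᵥ w) := by
  rw [Fin.sum_univ_succ] at hu
  simp only [dotProduct, basedGram_mulVec_tail hw, Fin.tail, Fin.sum_univ_succ (n := n),
    mul_sub, Finset.sum_sub_distrib, ← Finset.sum_mul]
  linear_combination (m *ᵥ w) 0 * hu

lemma tail_ne_zero_of_sum_eq_zero (hw : ∑ i, w i = 0) (hw₀ : w ≠ 0) : Fin.tail w ≠ 0 := by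
  intro h
  have hsucc (i : Fin n) : w i.succ = 0 := congrFun h i
  refine hw₀ (funext (Fin.cases ?_ hsucc))
  simpa only [Fin.sum_univ_succ, hsucc, Finset.sum_const_zero, add_zero,
    Pi.zero_apply] using hw

/-- The coefficients `w` of an affine dependency, read off from the squared distances `m` of the
points: if `∑ wᵢ = 0`, then `m *ᵥ w` is constant exactly when `∑ wᵢ pᵢ` is orthogonal to all
differences `pᵢ - pⱼ`. When the differences span a degenerate subspace, this is weaker than
`∑ wᵢ pᵢ = 0`. -/
def IsAffineDependency (m : Matrix (Fin (n + 1)) (Fin (n + 1)) R) (w : Fin (n + 1) → R) : Prop :=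
  ∑ i, w i = 0 ∧ ∀ i j, (m *ᵥ w) i = (m *ᵥ w) j

lemma isAffineDependency_iff_basedGram_mulVec_tail (hw : ∑ i, w i = 0) :
    IsAffineDependency m w ↔ basedGram m *ᵥ Fin.tail w = 0 := by
  simp only [IsAffineDependency, hw, true_and, funext_iff, basedGram_mulVec_tail hw,
    Pi.zero_apply, sub_eq_zero]
  refine ⟨fun h i => h 0 i.succ, fun h => ?_⟩
  have h₀ (i : Fin (n + 1)) : (m *ᵥ w) 0 = (m *ᵥ w) i := Fin.cases rfl h i
  exact fun i j => (h₀ i).symm.trans (h₀ j)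

end BasedGram

section Realizability

variable {K : Type*} [Field K] {n d : ℕ} {m : Matrix (Fin (n + 1)) (Fin (n + 1)) K}

lemma basedGram_sqDist (p : Fin (n + 1) → Fin d → K) :
    basedGram (of fun i j => ∑ k, (p i k - p j k) ^ 2) =
      2 • ((of fun (i : Fin n) k => p i.succ k - p 0 k) *
        (of fun (i : Fin n) k => p i.succ k - p 0 k)ᵀ) := by
  ext i j
  simp only [basedGram, of_apply, Matrix.smul_apply, mul_apply, transpose_apply, nsmul_eq_mul,
    Finset.mul_sum, ← Finset.sum_add_distrib, ← Finset.sum_sub_distrib]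
  exact Finset.sum_congr rfl fun k _ => by push_cast; ring

variable [IsAlgClosed K] [NeZero (2 : K)]

lemma exists_sqDist_eq_of_rank_basedGram_le (hsymm : m.IsSymm) (hdiag : ∀ i, m i i = 0)
    (hrank : (basedGram m).rank ≤ d) :
    ∃ p : Fin (n + 1) → Fin d → K, ∀ i j, m i j = ∑ k, (p i k - p j k) ^ 2 := by
  obtain ⟨P, hP⟩ := exists_mul_transpose_eq_of_rank_le (A := (2 : K)⁻¹ • basedGram m)
    ((isSymm_basedGram hsymm).smul _) (d := d) (by
      rwa [rank_smul_of_mem_nonZeroDivisors _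
        (mem_nonZeroDivisors_of_ne_zero (inv_ne_zero two_ne_zero))])
  have hinner (i j : Fin n) :
      2 * ∑ k, P i k * P j k = m i.succ 0 + m 0 j.succ - m i.succ j.succ := by
    have hij := congrFun₂ hP i j
    simp only [mul_apply, transpose_apply, Matrix.smul_apply, basedGram, of_apply, hdiag,
      sub_zero, smul_eq_mul] at hij
    rw [hij, mul_inv_cancel_left₀ two_ne_zero]
  have hnorm (i : Fin n) : ∑ k, P i k * P i k = m 0 i.succ := by
    refine mul_left_cancel₀ (two_ne_zero (α := K)) ?_
    rw [hinner, hdiag, hsymm.apply 0 i.succ]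
    ring
  let p : Fin (n + 1) → Fin d → K := Fin.cons 0 fun i => P i
  have hp₀ (k : Fin d) : p 0 k = 0 := rfl
  have hp (i : Fin n) (k : Fin d) : p i.succ k = P i k := rfl
  refine ⟨p, Fin.cases (Fin.cases ?_ fun j => ?_) fun i => Fin.cases ?_ fun j => ?_⟩
  · simp only [sub_self, hdiag, ne_eq, two_ne_zero, not_false_eq_true, zero_pow,
      Finset.sum_const_zero]
  · simp only [hp₀, hp, zero_sub, neg_sq, ← hnorm, ← sq]
  · simp only [hp₀, hp, sub_zero, hsymm.apply 0 i.succ, ← hnorm, sq]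
  · calc m i.succ j.succ
        = ∑ k, P i k * P i k + ∑ k, P j k * P j k - 2 * ∑ k, P i k * P j k := by
          rw [hinner, hnorm, hnorm, hsymm.apply 0 i.succ]
          ring
      _ = ∑ k, (p i.succ k - p j.succ k) ^ 2 := by
          rw [Finset.mul_sum, ← Finset.sum_add_distrib, ← Finset.sum_sub_distrib]
          refine Finset.sum_congr rfl fun k _ => ?_
          rw [hp, hp]
          ring

theorem exists_sqDist_eq_iff_rank_basedGram_le (hsymm : m.IsSymm) (hdiag : ∀ i, m i i = 0) :
    (∃ p : Fin (n + 1) → Fin d → K, ∀ i j, m i j = ∑ k, (p i k - p j k) ^ 2) ↔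
      (basedGram m).rank ≤ d := by
  refine ⟨?_, exists_sqDist_eq_of_rank_basedGram_le hsymm hdiag⟩
  rintro ⟨p, hp⟩
  obtain rfl : m = of fun i j => ∑ k, (p i k - p j k) ^ 2 := by ext i j; exact hp i j
  rw [basedGram_sqDist, ← Matrix.smul_mul]
  exact (rank_mul_le_left _ _).trans (rank_le_width _)

end Realizability

section Lengths

variable {n d : ℕ}

lemma len_of_lt {i j : Fin n} (h : i < j) (l : Edge n → ℂ) : len i j l = l ⟨(i, j), h⟩ := by
  simp [len, h]

lemma len_self (i : Fin n) : len i i = 0 := by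
  simp [len]

lemma len_comm (i j : Fin n) : len i j = len j i := by
  unfold len
  rcases lt_trichotomy i j with h | h | h
  · simp [h, h.not_gt]
  · simp [h]
  · simp [h, h.not_gt]

/-- The symmetric matrix of the squares `l_{ij}²`. -/
def sqLenMatrix (l : Edge n → ℂ) : Matrix (Fin n) (Fin n) ℂ := of fun i j => len i j l ^ 2

lemma isSymm_sqLenMatrix (l : Edge n → ℂ) : (sqLenMatrix l).IsSymm :=
  IsSymm.ext fun i j => by simp only [sqLenMatrix, of_apply, len_comm]

lemma sqLenMatrix_self (l : Edge n → ℂ) (i : Fin n) : sqLenMatrix l i i = 0 := by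
  simp [sqLenMatrix, len_self]

lemma squaringMap_eq_sqLengths_iff {l : Edge n → ℂ} {p : Fin n → Fin d → ℂ} :
    squaringMap l = sqLengths p ↔ ∀ i j, sqLenMatrix l i j = ∑ k, (p i k - p j k) ^ 2 := by
  simp only [sqLenMatrix, of_apply]
  constructor
  · intro h i j
    rcases lt_trichotomy i j with hij | rfl | hij
    · rw [len_of_lt hij]
      exact congrFun h ⟨(i, j), hij⟩
    · simp [len_self]
    · rw [len_comm, len_of_lt hij]
      refine (congrFun h ⟨(j, i), hij⟩).trans (Finset.sum_congr rfl fun k _ => ?_)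
      ring
  · intro h
    ext e
    exact (congrArg (· ^ 2) (len_of_lt e.2 l)).symm.trans (h _ _)

lemma mem_unsquaredMeasurementVariety {l : Edge n → ℂ} :
    l ∈ unsquaredMeasurementVariety d n ↔
      ∃ p : Fin n → Fin d → ℂ, ∀ i j, sqLenMatrix l i j = ∑ k, (p i k - p j k) ^ 2 := by
  simp only [← squaringMap_eq_sqLengths_iff]
  exact exists_congr fun p => eq_comm

theorem mem_unsquaredMeasurementVariety_iff_rank_le {l : Edge (n + 1) → ℂ} :
    l ∈ unsquaredMeasurementVariety d (n + 1) ↔ (basedGram (sqLenMatrix l)).rank ≤ d :=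
  mem_unsquaredMeasurementVariety.trans
    (exists_sqDist_eq_iff_rank_basedGram_le (isSymm_sqLenMatrix l) (sqLenMatrix_self l))

end Lengths

section CayleyMenger

variable {n d : ℕ}

/-- The coordinate `l_{ij}` as a polynomial, with the conventions of `len`. -/
noncomputable def lenPoly (i j : Fin n) : MvPolynomial (Edge n) ℂ :=
  if h : i < j then X ⟨(i, j), h⟩ else if h : j < i then X ⟨(j, i), h⟩ else 0

lemma eval_lenPoly (l : Edge n → ℂ) (i j : Fin n) : eval l (lenPoly i j) = len i j l := by
  unfold lenPoly len
  split_ifs <;> simp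

lemma pderiv_lenPoly (e : Edge n) (i j : Fin n) :
    pderiv e (lenPoly i j) = C (len i j (Pi.single e 1)) := by
  unfold lenPoly len
  split_ifs <;> simp [pderiv_X, Pi.single_apply, eq_comm]

/-- The Cayley–Menger determinant of `n + 1` points as a polynomial in their mutual distances,
in the form of an `n × n` Gram determinant rather than a bordered one. -/
noncomputable def cayleyMengerPoly (n : ℕ) : MvPolynomial (Edge (n + 1)) ℂ :=
  (basedGram (of fun i j => lenPoly i j ^ 2)).det

lemma map_eval_basedGram_lenPoly (l : Edge (n + 1) → ℂ) :
    (basedGram (of fun i j => lenPoly i j ^ 2)).map (eval l) = basedGram (sqLenMatrix l) := by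
  rw [map_basedGram]
  congr 1
  ext i j
  simp [sqLenMatrix, eval_lenPoly]

lemma eval_cayleyMengerPoly (l : Edge (n + 1) → ℂ) :
    eval l (cayleyMengerPoly n) = (basedGram (sqLenMatrix l)).det := by
  rw [cayleyMengerPoly, RingHom.map_det, RingHom.mapMatrix_apply, map_eval_basedGram_lenPoly]

lemma mem_unsquaredMeasurementVariety_iff_eval_cayleyMengerPoly {l : Edge (n + 2) → ℂ} :
    l ∈ unsquaredMeasurementVariety n (n + 2) ↔ eval l (cayleyMengerPoly (n + 1)) = 0 := by
  rw [mem_unsquaredMeasurementVariety_iff_rank_le, eval_cayleyMengerPoly,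
    det_eq_zero_iff_rank_lt_card, Fintype.card_fin, Nat.lt_succ_iff]

lemma eval_pderiv_cayleyMengerPoly (l : Edge (n + 1) → ℂ) (e : Edge (n + 1)) :
    eval l (pderiv e (cayleyMengerPoly n)) =
      ((basedGram (sqLenMatrix l)).adjugate *
        basedGram (of fun i j => 2 * len i j l * len i j (Pi.single e 1))).trace := by
  have hderiv : ((basedGram (of fun i j : Fin (n + 1) => lenPoly i j ^ 2)).map (pderiv e)).map
      (eval l) = basedGram (of fun i j => 2 * len i j l * len i j (Pi.single e 1)) := by
    rw [map_basedGram, map_basedGram]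
    congr 1
    ext i j
    simp [eval_lenPoly, pderiv_lenPoly, mul_assoc]
  rw [cayleyMengerPoly, derivation_det, ← hderiv, ← map_eval_basedGram_lenPoly]
  rw [← RingHom.mapMatrix_apply, ← RingHom.mapMatrix_apply, ← RingHom.map_adjugate, ← map_mul]
  exact AddMonoidHom.map_trace (eval l).toAddMonoidHom _

lemma len_single (e : Edge n) (i j : Fin n) :
    len i j (Pi.single e 1) = (if (i, j) = e.1 then 1 else 0) + if (j, i) = e.1 then 1 else 0 := by
  obtain ⟨⟨a, b⟩, hab⟩ := e
  unfold len
  split_ifs <;> simp [Pi.single_apply] <;> grind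

lemma dotProduct_mulVec_len_mul_len_single (l : Edge n → ℂ) (w : Fin n → ℂ) (e : Edge n) :
    w ⬝ᵥ (of fun i j => 2 * len i j l * len i j (Pi.single e 1)) *ᵥ w =
      4 * (l e * w e.1.1 * w e.1.2) := by
  have hle : len e.1.1 e.1.2 l = l e := len_of_lt e.2 l
  let F (a : Fin n × Fin n) : ℂ := 2 * (len a.1 a.2 l * w a.1 * w a.2)
  calc w ⬝ᵥ (of fun i j => 2 * len i j l * len i j (Pi.single e 1)) *ᵥ w
      = ∑ i, ∑ j, F (i, j) * len i j (Pi.single e 1) := by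
        simp only [dotProduct, mulVec, of_apply, Finset.mul_sum]
        exact Finset.sum_congr rfl fun i _ => Finset.sum_congr rfl fun j _ => by ring
    _ = ∑ a, F a * (if a = e.1 then 1 else 0) + ∑ a, F a * (if a.swap = e.1 then 1 else 0) := by
        simp only [len_single, mul_add, Finset.sum_add_distrib, Fintype.sum_prod_type,
          Prod.swap_prod_mk]
    _ = F e.1 + F e.1.swap := by
        simp only [Prod.swap_eq_iff_eq_swap, mul_ite, mul_one, mul_zero, Finset.sum_ite_eq',
          Finset.mem_univ, if_true]
    _ = 4 * (l e * w e.1.1 * w e.1.2) := by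
        simp only [F, Prod.fst_swap, Prod.snd_swap, len_comm e.1.2, hle]
        ring

lemma eval_pderiv_cayleyMengerPoly_of_adjugate_eq {l : Edge (n + 1) → ℂ} {w : Fin (n + 1) → ℂ}
    (hw : ∑ i, w i = 0) {c : ℂ}
    (hadj : (basedGram (sqLenMatrix l)).adjugate = c • vecMulVec (Fin.tail w) (Fin.tail w))
    (e : Edge (n + 1)) :
    eval l (pderiv e (cayleyMengerPoly n)) = -4 * c * (l e * w e.1.1 * w e.1.2) := by
  rw [eval_pderiv_cayleyMengerPoly, hadj, Matrix.smul_mul, trace_smul, vecMulVec_mul,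
    trace_vecMulVec, dotProduct_comm, ← dotProduct_mulVec,
    tail_dotProduct_basedGram_mulVec_tail hw hw, dotProduct_mulVec_len_mul_len_single, smul_eq_mul]
  ring

lemma forall_len_mul_mul_eq_zero_iff {l : Edge n → ℂ} {w : Fin n → ℂ} :
    (∀ i j, len i j l * w i * w j = 0) ↔ ∀ e : Edge n, l e * w e.1.1 * w e.1.2 = 0 := by
  constructor
  · intro h e
    rw [← len_of_lt e.2 l]
    exact h _ _
  · intro h i j
    rcases lt_trichotomy i j with hij | rfl | hij
    · rw [len_of_lt hij]
      exact h ⟨(i, j), hij⟩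
    · simp [len_self]
    · rw [len_comm, len_of_lt hij, mul_right_comm]
      exact h ⟨(j, i), hij⟩

theorem cayleyMengerPoly_critical_iff {l : Edge (d + 3) → ℂ} :
    (eval l (cayleyMengerPoly (d + 2)) = 0 ∧
        ∀ e, eval l (pderiv e (cayleyMengerPoly (d + 2))) = 0) ↔
      l ∈ unsquaredMeasurementVariety d (d + 3) ∨
        ∃ w ≠ 0, IsAffineDependency (sqLenMatrix l) w ∧ ∀ i j, len i j l * w i * w j = 0 := by
  have hL : l ∈ unsquaredMeasurementVariety d (d + 3) ↔
      (basedGram (sqLenMatrix l)).adjugate = 0 := by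
    rw [mem_unsquaredMeasurementVariety_iff_rank_le, adjugate_eq_zero_iff_rank_add_one_lt,
      Fintype.card_fin]
    lia
  have hsymm := isSymm_basedGram (isSymm_sqLenMatrix l)
  simp only [hL, eval_cayleyMengerPoly, forall_len_mul_mul_eq_zero_iff]
  constructor
  · rintro ⟨hdet, hcrit⟩
    obtain ⟨v, hv₀, hv⟩ := exists_mulVec_eq_zero_iff.2 hdet
    obtain ⟨c, hc⟩ := exists_adjugate_eq_smul_vecMulVec hsymm hv hv₀
    rcases eq_or_ne c 0 with rfl | hc₀
    · left
      rw [hc, zero_smul]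
    · right
      let w : Fin (d + 3) → ℂ := Fin.cons (-∑ i, v i) v
      have hw : ∑ i, w i = 0 := by simp [w, Fin.sum_univ_succ (n := d + 2)]
      refine ⟨w, fun h => hv₀ (congrArg Fin.tail h),
        (isAffineDependency_iff_basedGram_mulVec_tail hw).2 hv, fun e => ?_⟩
      have he := hcrit e
      rw [eval_pderiv_cayleyMengerPoly_of_adjugate_eq hw hc] at he
      exact (mul_eq_zero.1 he).resolve_left (mul_ne_zero (by norm_num) hc₀)
  · rintro (hadj | ⟨w, hw₀, hw, hlw⟩)
    · refine ⟨?_, fun e => by rw [eval_pderiv_cayleyMengerPoly, hadj, Matrix.zero_mul, trace_zero]⟩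
      exact det_eq_zero_of_adjugate_eq_zero hadj
    · have htail := tail_ne_zero_of_sum_eq_zero hw.1 hw₀
      have hker := (isAffineDependency_iff_basedGram_mulVec_tail hw.1).1 hw
      obtain ⟨c, hc⟩ := exists_adjugate_eq_smul_vecMulVec hsymm hker htail
      refine ⟨exists_mulVec_eq_zero_iff.1 ⟨_, htail, hker⟩, fun e => ?_⟩
      rw [eval_pderiv_cayleyMengerPoly_of_adjugate_eq hw.1 hc, hlw, mul_zero]

end CayleyMenger

section Dependencies

variable {n : ℕ}

lemma isAffineDependency_smul_iff {K : Type*} [Field K]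
    {m : Matrix (Fin (n + 1)) (Fin (n + 1)) K} {c : K} (hc : c ≠ 0) {w : Fin (n + 1) → K} :
    IsAffineDependency m (c • w) ↔ IsAffineDependency m w := by
  simp only [IsAffineDependency, Pi.smul_apply, mulVec_smul, smul_eq_mul, ← Finset.mul_sum,
    mul_eq_zero_iff_left hc, mul_right_inj' hc]

lemma isAffineDependency_single_sub_single_iff {l : Edge (n + 1) → ℂ} {i j : Fin (n + 1)} :
    IsAffineDependency (sqLenMatrix l) (Pi.single i 1 - Pi.single j 1) ↔
      ∀ k, len i k l ^ 2 = len j k l ^ 2 := by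
  have hmul (k : Fin (n + 1)) : (sqLenMatrix l *ᵥ (Pi.single i 1 - Pi.single j 1)) k =
      len i k l ^ 2 - len j k l ^ 2 := by
    simp [mulVec_sub, sqLenMatrix, len_comm k]
  simp only [IsAffineDependency, hmul, Pi.sub_apply, Finset.sum_sub_distrib,
    Finset.sum_pi_single', Finset.mem_univ, if_true, sub_self, true_and]
  constructor
  · intro h k
    have hij := h i j
    have hkj := h k j
    rw [len_self, len_self, len_comm j i, LinearMap.zero_apply] at hij
    rw [len_self, LinearMap.zero_apply] at hkj
    linear_combination hkj - hij / 2
  · intro h k k'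
    rw [h k, h k', sub_self, sub_self]

lemma eq_smul_single_sub_single {K : Type*} [Ring K] {w : Fin n → K} (hw : ∑ i, w i = 0)
    {i j : Fin n} (hij : i ≠ j) (h : ∀ k, k ≠ i → k ≠ j → w k = 0) :
    w = w i • (Pi.single i 1 - Pi.single j 1) := by
  have hj : w j = -w i := by
    rw [Fintype.sum_eq_add i j hij fun k hk => h k hk.1 hk.2] at hw
    exact eq_neg_of_add_eq_zero_right hw
  ext k
  by_cases hki : k = i
  · simp [hki, hij]
  · by_cases hkj : k = j
    · simp [hkj, hij.symm, hj]
    · simp [hki, hkj, h k hki hkj]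

lemma len_mul_single_sub_single_eq_zero {l : Edge n → ℂ} {i j : Fin n} (hl : len i j l = 0)
    (a b : Fin n) :
    len a b l * (Pi.single i 1 - Pi.single j 1 : Fin n → ℂ) a *
      (Pi.single i 1 - Pi.single j 1 : Fin n → ℂ) b = 0 := by
  have hne (k) (hk : ¬(k = i ∨ k = j)) : (Pi.single i 1 - Pi.single j 1 : Fin n → ℂ) k = 0 := by
    rw [not_or] at hk
    simp [hk.1, hk.2]
  by_cases ha : a = i ∨ a = j
  · by_cases hb : b = i ∨ b = j
    · have hab : len a b l = 0 := by
        rcases ha with ha | ha <;> rcases hb with hb | hb <;>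
          simp [ha, hb, len_self, hl, len_comm j i]
      rw [hab, zero_mul, zero_mul]
    · rw [hne b hb, mul_zero]
  · rw [hne a ha, mul_zero, zero_mul]

lemma exists_isAffineDependency_of_forall_ne_len_eq_zero {l : Edge (n + 4) → ℂ} {h : Fin (n + 4)}
    (hl : ∀ i j, i ≠ h → j ≠ h → len i j l = 0) :
    ∃ w ≠ 0, IsAffineDependency (sqLenMatrix l) w ∧ w h = 0 := by
  -- Away from `h`, each row of `sqLenMatrix l` is supported at `h`, so it annihilates `w`.
  let A : Matrix (Fin 3) (Fin (n + 4)) ℂ := of ![Pi.single h 1, 1, sqLenMatrix l h]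
  have hker : LinearMap.ker A.mulVecLin ≠ ⊥ := LinearMap.ker_ne_bot_of_finrank_lt (by simp)
  obtain ⟨w, hw, hw₀⟩ := Submodule.exists_mem_ne_zero_of_ne_bot hker
  have hAw (i : Fin 3) : A i ⬝ᵥ w = 0 := congrFun (LinearMap.mem_ker.1 hw) i
  have hwh : w h = 0 := (single_one_dotProduct h w).symm.trans (hAw 0)
  have hmul (i : Fin (n + 4)) : (sqLenMatrix l *ᵥ w) i = 0 := by
    rcases eq_or_ne i h with rfl | hi
    · exact hAw 2
    · rw [mulVec, dotProduct]
      refine Finset.sum_eq_zero fun k _ => ?_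
      rcases eq_or_ne k h with rfl | hk
      · rw [hwh, mul_zero]
      · rw [sqLenMatrix, of_apply, hl i k hi hk, zero_pow two_ne_zero, zero_mul]
  exact ⟨w, hw₀, ⟨(one_dotProduct w).symm.trans (hAw 1), fun i j => by rw [hmul, hmul]⟩, hwh⟩

theorem exists_isAffineDependency_len_mul_eq_zero_iff {l : Edge 4 → ℂ} :
    (∃ w ≠ 0, IsAffineDependency (sqLenMatrix l) w ∧ ∀ i j, len i j l * w i * w j = 0) ↔
      (∃ i j, i ≠ j ∧ ∀ k, len i k l ^ 2 = len j k l ^ 2) ∨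
        ∃ h, ∀ i j, i ≠ h → j ≠ h → len i j l = 0 := by
  constructor
  · rintro ⟨w, hw₀, hw, hlw⟩
    have hl (i j) (hi : w i ≠ 0) (hj : w j ≠ 0) : len i j l = 0 :=
      (mul_eq_zero.1 ((mul_eq_zero.1 (hlw i j)).resolve_right hj)).resolve_right hi
    obtain ⟨i, hi⟩ := Function.ne_iff.1 hw₀
    obtain ⟨j, hji, hj⟩ : ∃ j, j ≠ i ∧ w j ≠ 0 := by
      by_contra! h
      exact hi ((Fintype.sum_eq_single i h).symm.trans hw.1)
    by_cases hpair : ∀ k, k ≠ i → k ≠ j → w k = 0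
    · left
      rw [eq_smul_single_sub_single hw.1 hji.symm hpair, isAffineDependency_smul_iff hi] at hw
      exact ⟨i, j, hji.symm, isAffineDependency_single_sub_single_iff.1 hw⟩
    · right
      push Not at hpair
      obtain ⟨k, hki, hkj, hk⟩ := hpair
      obtain ⟨h, hh⟩ : ∃ h : Fin 4, ∀ x, x ≠ h → x = i ∨ x = j ∨ x = k := by
        clear hi hj hk; revert i j k; decide
      have hwh (x) (hx : x ≠ h) : w x ≠ 0 := by
        rcases hh x hx with rfl | rfl | rfl <;> assumption
      exact ⟨h, fun x y hx hy => hl x y (hwh x hx) (hwh y hy)⟩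
  · rintro (⟨i, j, hij, h⟩ | ⟨h, hl⟩)
    · refine ⟨Pi.single i 1 - Pi.single j 1, fun h₀ => ?_,
        isAffineDependency_single_sub_single_iff.2 h, fun a b => ?_⟩
      · simpa [hij] using congrFun h₀ i
      · exact len_mul_single_sub_single_eq_zero (by simpa [len_self] using h j) a b
    · obtain ⟨w, hw₀, hw, hwh⟩ := exists_isAffineDependency_of_forall_ne_len_eq_zero hl
      refine ⟨w, hw₀, hw, fun i j => ?_⟩
      by_cases hi : i = h
      · rw [hi, hwh, mul_zero, zero_mul]
      by_cases hj : j = h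
      · rw [hj, hwh, mul_zero]
      · rw [hl i j hi hj, zero_mul, zero_mul]

end Dependencies

section Irreducibility

lemma irreducible_biquadratic_of_eisenstein {R : Type*} [CommRing R] [IsDomain R] {P : Ideal R}
    (hP : P.IsPrime) {a b c : R} (ha : a ∉ P) (hb : b ∈ P) (hc : c ∈ P) (hc_sq : c ∉ P ^ 2)
    (hprim : ∀ r, r ∣ a → r ∣ c → IsUnit r) :
    Irreducible (Polynomial.C a * Polynomial.X ^ 4 + Polynomial.C b * Polynomial.X ^ 2 +
      Polynomial.C c) := by
  set p := Polynomial.C a * Polynomial.X ^ 4 + Polynomial.C b * Polynomial.X ^ 2 + Polynomial.C c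
    with hp
  have ha₀ : a ≠ 0 := fun h => ha (h ▸ P.zero_mem)
  have hdeg : p.natDegree = 4 := by
    rw [hp]
    compute_degree!
  have hp₀ : p ≠ 0 := by
    rintro h
    simp [h] at hdeg
  have hcoeff (k : ℕ) : p.coeff k = (if k = 4 then a else 0) + (if k = 2 then b else 0) +
      if k = 0 then c else 0 := by
    simp [hp, Polynomial.coeff_X_pow, Polynomial.coeff_C]
  refine Polynomial.irreducible_of_eisenstein_criterion hP ?_ (fun k hk => ?_) ?_ ?_
    fun r hr => ?_
  · simpa [Polynomial.leadingCoeff, hdeg, hcoeff] using ha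
  · rw [Polynomial.degree_eq_natDegree hp₀, hdeg, Nat.cast_lt] at hk
    rw [hcoeff]
    split_ifs <;> first | lia | simp [hb, hc]
  · simp [Polynomial.degree_eq_natDegree hp₀, hdeg]
  · simpa [hcoeff] using hc_sq
  · rw [Polynomial.C_dvd_iff_dvd_coeff] at hr
    exact hprim r (by simpa [hcoeff] using hr 4) (by simpa [hcoeff] using hr 0)

lemma eval_pderiv_eq_zero_of_mem_ker_sq {R σ : Type*} [CommRing R] {x : σ → R}
    {p : MvPolynomial σ R} (hp : p ∈ RingHom.ker (eval x) ^ 2) (i : σ) :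
    eval x (pderiv i p) = 0 := by
  rw [sq] at hp
  induction hp using Submodule.mul_induction_on' with
  | mem_mul_mem a ha b hb =>
    rw [RingHom.mem_ker] at ha hb
    simp [ha, hb]
  | add a _ b _ ha hb => rw [map_add, map_add, ha, hb, add_zero]

/-- The coefficient of `m₀₁` in half of the Cayley–Menger determinant of a tetrahedron, as a
function of the other squared lengths `b = m₀₂`, `c = m₀₃`, `d = m₁₂`, `e = m₁₃`, `f = m₂₃`. -/
def cayleyMengerLinearCoeff {R : Type*} [CommRing R] (b c d e f : R) : R :=
  f * (b + c + d + e - f) + (b - c) * (e - d)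

/-- Half of the Cayley–Menger determinant of a tetrahedron with `m₀₁ = 0`, as a function of the
squared lengths `b = m₀₂`, `c = m₀₃`, `d = m₁₂`, `e = m₁₃`, `f = m₂₃`. -/
def cayleyMengerConstCoeff {R : Type*} [CommRing R] (b c d e f : R) : R :=
  b * e * (c + d + f - b - e) + c * d * (b + e + f - c - d) - f * (b * c + d * e)

lemma det_basedGram_tetrahedron {R : Type*} [CommRing R] (a b c d e f : R) :
    (basedGram !![0, a, b, c; a, 0, d, e; b, d, 0, f; c, e, f, 0]).det =
      2 * (-f * a ^ 2 + cayleyMengerLinearCoeff b c d e f * a +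
        cayleyMengerConstCoeff b c d e f) := by
  rw [det_fin_three]
  simp only [basedGram, of_apply, cons_val, Fin.reduceSucc, cayleyMengerLinearCoeff,
    cayleyMengerConstCoeff]
  ring

/-- The edges of the tetrahedron in lexicographic order. -/
def tetrahedronEdge : Fin 6 → Edge 4 :=
  ![⟨(0, 1), by decide⟩, ⟨(0, 2), by decide⟩, ⟨(0, 3), by decide⟩, ⟨(1, 2), by decide⟩,
    ⟨(1, 3), by decide⟩, ⟨(2, 3), by decide⟩]

lemma tetrahedronEdge_bijective : Function.Bijective tetrahedronEdge := by
  decide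

/-- Half of the Cayley–Menger determinant of a tetrahedron as a polynomial in `l₀₁`, with
coefficients in the lengths `l₀₂, l₀₃, l₁₂, l₁₃, l₂₃` of the other edges, in this order. -/
noncomputable def tetrahedronQuartic : Polynomial (MvPolynomial (Fin 5) ℂ) :=
  Polynomial.C (-X 4 ^ 2) * Polynomial.X ^ 4 +
    Polynomial.C (cayleyMengerLinearCoeff (X 0 ^ 2) (X 1 ^ 2) (X 2 ^ 2) (X 3 ^ 2) (X 4 ^ 2)) *
      Polynomial.X ^ 2 +
    Polynomial.C (cayleyMengerConstCoeff (X 0 ^ 2) (X 1 ^ 2) (X 2 ^ 2) (X 3 ^ 2) (X 4 ^ 2))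

lemma irreducible_tetrahedronQuartic : Irreducible tetrahedronQuartic := by
  -- At this point `p₀` is the midpoint of `p₂ p₃`, and `m₀₁ = 0` is a double root.
  let x : Fin 5 → ℂ := ![5, 5, 7, 1, 10]
  refine irreducible_biquadratic_of_eisenstein (P := RingHom.ker (eval x)) (RingHom.ker_isPrime _)
    ?_ ?_ ?_ (fun h => ?_) fun r hr₄ hr₀ => ?_
  · simp [RingHom.mem_ker, x]
  · suffices (10 : ℂ) ^ 2 * (5 ^ 2 + 5 ^ 2 + 7 ^ 2 + 1 - 10 ^ 2) = 0 by
      simpa [RingHom.mem_ker, cayleyMengerLinearCoeff, x]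
    norm_num
  · suffices (5 : ℂ) ^ 2 * (5 ^ 2 + 7 ^ 2 + 10 ^ 2 - 5 ^ 2 - 1) +
        5 ^ 2 * 7 ^ 2 * (5 ^ 2 + 1 + 10 ^ 2 - 5 ^ 2 - 7 ^ 2) -
        10 ^ 2 * (5 ^ 2 * 5 ^ 2 + 7 ^ 2) = 0 by
      simpa [RingHom.mem_ker, cayleyMengerConstCoeff, x]
    norm_num
  · have hderiv : eval x (pderiv 4 (cayleyMengerConstCoeff (X 0 ^ 2) (X 1 ^ 2) (X 2 ^ 2) (X 3 ^ 2)
        (X 4 ^ 2))) = 2 * 10 * (5 ^ 2 * 1 + 5 ^ 2 * 7 ^ 2 - (5 ^ 2 * 5 ^ 2 + 7 ^ 2 * 1)) := by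
      simp [cayleyMengerConstCoeff, x, pderiv_X, Derivation.leibniz_pow]
      ring
    rw [eval_pderiv_eq_zero_of_mem_ker_sq h 4] at hderiv
    norm_num at hderiv
  · obtain ⟨k, -, hk⟩ := (dvd_prime_pow (X_prime (R := ℂ) (i := (4 : Fin 5))) 2).1
      ((dvd_neg).1 hr₄)
    rcases k.eq_zero_or_pos with rfl | hk₀
    · exact hk.symm.isUnit (by simp)
    · obtain ⟨q, hq⟩ := ((dvd_pow_self _ hk₀.ne').trans hk.symm.dvd).trans hr₀
      let y : Fin 5 → ℂ := ![1, 2, 0, 1, 0]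
      have hval : eval y (cayleyMengerConstCoeff (X 0 ^ 2) (X 1 ^ 2) (X 2 ^ 2)
          (X 3 ^ 2) (X 4 ^ 2)) = 2 := by
        simp [cayleyMengerConstCoeff, y]
        norm_num
      rw [hq] at hval
      simp [y] at hval

/-- The variable `l₀₁` separated from the lengths of the other five edges of the tetrahedron. -/
noncomputable def tetrahedronPolyEquiv :
    MvPolynomial (Edge 4) ℂ ≃ₐ[ℂ] Polynomial (MvPolynomial (Fin 5) ℂ) :=
  (renameEquiv ℂ (Equiv.ofBijective _ tetrahedronEdge_bijective).symm).trans (finSuccEquiv ℂ 5)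

lemma tetrahedronPolyEquiv_X_zero :
    tetrahedronPolyEquiv (X (tetrahedronEdge 0)) = Polynomial.X := by
  simp [tetrahedronPolyEquiv, finSuccEquiv_X_zero]

lemma tetrahedronPolyEquiv_X_succ (k : Fin 5) :
    tetrahedronPolyEquiv (X (tetrahedronEdge k.succ)) = Polynomial.C (X k) := by
  simp [tetrahedronPolyEquiv, finSuccEquiv_X_succ]

theorem irreducible_cayleyMengerPoly_three : Irreducible (cayleyMengerPoly 3) := by
  have hmat : (of fun i j : Fin 4 => lenPoly i j ^ 2).map tetrahedronPolyEquiv =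
      let y := fun k : Fin 5 => (Polynomial.C (X k : MvPolynomial (Fin 5) ℂ) ^ 2)
      !![0, Polynomial.X ^ 2, y 0, y 1; Polynomial.X ^ 2, 0, y 2, y 3;
        y 0, y 2, 0, y 4; y 1, y 3, y 4, 0] := by
    have h₀ := tetrahedronPolyEquiv_X_zero
    have hsucc := tetrahedronPolyEquiv_X_succ
    simp only [tetrahedronEdge, Fin.forall_fin_succ] at h₀ hsucc
    ext i j : 2
    fin_cases i <;> fin_cases j <;> simp_all [lenPoly]
  have hdet : tetrahedronPolyEquiv (cayleyMengerPoly 3) = 2 * tetrahedronQuartic := by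
    rw [cayleyMengerPoly, AlgEquiv.map_det, AlgEquiv.mapMatrix_apply, map_basedGram, hmat,
      det_basedGram_tetrahedron]
    simp only [tetrahedronQuartic, cayleyMengerLinearCoeff, cayleyMengerConstCoeff, map_add,
      map_sub, map_mul, map_pow, map_neg]
    ring
  have htwo : IsUnit (2 : Polynomial (MvPolynomial (Fin 5) ℂ)) := by
    have h := (isUnit_of_invertible (2 : ℂ)).map
      (algebraMap ℂ (Polynomial (MvPolynomial (Fin 5) ℂ)))
    rwa [map_ofNat] at h
  rw [← MulEquiv.irreducible_iff tetrahedronPolyEquiv, hdet, irreducible_isUnit_mul htwo]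
  exact irreducible_tetrahedronQuartic

end Irreducibility

section Faces

variable {n : ℕ}

/-- The lengths of the edges of the face opposite to the vertex `h`. -/
def faceLengths (h : Fin (n + 1)) : (Edge (n + 1) → ℂ) →ₗ[ℂ] (Edge n → ℂ) :=
  LinearMap.pi fun e => len (h.succAbove e.1.1) (h.succAbove e.1.2)

/-- The lengths of the edges at the vertex `h`. -/
def starLengths (h : Fin (n + 1)) : (Edge (n + 1) → ℂ) →ₗ[ℂ] (Fin n → ℂ) :=
  LinearMap.pi fun t => len h (h.succAbove t)

lemma len_faceLengths (h : Fin (n + 1)) (l : Edge (n + 1) → ℂ) (a b : Fin n) :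
    len a b (faceLengths h l) = len (h.succAbove a) (h.succAbove b) l := by
  rcases lt_trichotomy a b with hab | rfl | hab
  · rw [len_of_lt hab]
    rfl
  · simp [len_self]
  · rw [len_comm, len_of_lt hab, len_comm]
    rfl

lemma faceLengths_eq_zero_iff {h : Fin (n + 1)} {l : Edge (n + 1) → ℂ} :
    faceLengths h l = 0 ↔ ∀ i j, i ≠ h → j ≠ h → len i j l = 0 := by
  constructor
  · intro hl i j hi hj
    obtain ⟨a, rfl⟩ := Fin.exists_succAbove_eq hi
    obtain ⟨b, rfl⟩ := Fin.exists_succAbove_eq hj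
    rw [← len_faceLengths, hl, map_zero]
  · intro hl
    ext e
    exact hl _ _ (h.succAbove_ne _) (h.succAbove_ne _)

lemma starLengths_eq_zero_iff {h : Fin (n + 1)} {l : Edge (n + 1) → ℂ} :
    starLengths h l = 0 ↔ ∀ i, len h i l = 0 := by
  constructor
  · intro hl i
    rcases eq_or_ne i h with rfl | hi
    · rw [len_self, LinearMap.zero_apply]
    · obtain ⟨a, rfl⟩ := Fin.exists_succAbove_eq hi
      exact congrFun hl a
  · intro hl
    ext t
    exact hl _

lemma eq_zero_of_starLengths_of_faceLengths {h : Fin (n + 1)} {l : Edge (n + 1) → ℂ}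
    (hstar : starLengths h l = 0) (hface : faceLengths h l = 0) : l = 0 := by
  rw [starLengths_eq_zero_iff] at hstar
  rw [faceLengths_eq_zero_iff] at hface
  ext e
  rw [← len_of_lt e.2 l, Pi.zero_apply]
  by_cases hi : e.1.1 = h
  · rw [hi, hstar]
  by_cases hj : e.1.2 = h
  · rw [hj, len_comm, hstar]
  exact hface _ _ hi hj

lemma mem_unsquaredMeasurementVariety_self_add_one (l : Edge (n + 1) → ℂ) :
    l ∈ unsquaredMeasurementVariety n (n + 1) :=
  mem_unsquaredMeasurementVariety_iff_rank_le.2 (rank_le_height _)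

theorem exists_collapsed_squaringMap_eq_sqLengths_iff {l : Edge (n + 2) → ℂ} {i j : Fin (n + 2)}
    (hij : i ≠ j) :
    (∃ p : Fin (n + 2) → Fin n → ℂ, p i = p j ∧ squaringMap l = sqLengths p) ↔
      ∀ k, len i k l ^ 2 = len j k l ^ 2 := by
  simp only [squaringMap_eq_sqLengths_iff]
  constructor
  · rintro ⟨p, hp, hl⟩ k
    exact (hl i k).trans (hp ▸ (hl j k).symm)
  · intro h
    obtain ⟨q, hq⟩ := mem_unsquaredMeasurementVariety.1
      (mem_unsquaredMeasurementVariety_self_add_one (faceLengths j l))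
    simp only [sqLenMatrix, of_apply, len_faceLengths] at hq ⊢
    obtain ⟨a, rfl⟩ := Fin.exists_succAbove_eq hij
    have hq_j (b : Fin (n + 1)) : len j (j.succAbove b) l ^ 2 = ∑ k, (q a k - q b k) ^ 2 := by
      rw [← h, hq]
    refine ⟨j.insertNth (q a) q, by simp, fun x y => ?_⟩
    cases x using j.succAboveCases <;> cases y using j.succAboveCases
    · simp [len_self]
    · simp [hq_j]
    · rw [len_comm]
      simp [hq_j, sub_sq_comm (q a _)]
    · simp [hq]

end Faces

section Coordinates

lemma bijective_domRestrict_ker {K V U U' : Type*} [Field K] [AddCommGroup V] [Module K V]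
    [AddCommGroup U] [Module K U] [AddCommGroup U'] [Module K U'] [FiniteDimensional K V]
    [FiniteDimensional K U] [FiniteDimensional K U'] {f : V →ₗ[K] U} {g : V →ₗ[K] U'}
    (hdim : Module.finrank K V = Module.finrank K U + Module.finrank K U')
    (h : ∀ v, f v = 0 → g v = 0 → v = 0) :
    Function.Bijective (g.domRestrict (LinearMap.ker f)) := by
  constructor
  · rw [← LinearMap.ker_eq_bot, LinearMap.ker_eq_bot']
    exact fun v hv => Subtype.ext (h v v.2 hv)
  · have hinj : Function.Injective (f.prod g) := by
      rw [← LinearMap.ker_eq_bot, LinearMap.ker_eq_bot']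
      exact fun v hv => h v (congrArg Prod.fst hv) (congrArg Prod.snd hv)
    have hsurj := (LinearMap.injective_iff_surjective_of_finrank_eq_finrank
      (hdim.trans (Module.finrank_prod).symm)).1 hinj
    intro y
    obtain ⟨v, hv⟩ := hsurj (0, y)
    exact ⟨⟨v, congrArg Prod.fst hv⟩, congrArg Prod.snd hv⟩

lemma card_edge_three : Fintype.card (Edge 3) = 3 := by
  decide

lemma card_edge_four : Fintype.card (Edge 4) = 6 := by
  decide

lemma sq_eq_sq_iff_exists_units_smul {R : Type*} [CommRing R] [NoZeroDivisors R] {x y : R} :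
    x ^ 2 = y ^ 2 ↔ ∃ s : ℤˣ, x = s • y := by
  rw [sq_eq_sq_iff_eq_or_eq_neg]
  constructor
  · rintro (h | h)
    · exact ⟨1, by rw [h, one_smul]⟩
    · exact ⟨-1, by rw [h, Units.neg_smul, one_smul]⟩
  · rintro ⟨s, rfl⟩
    rcases Int.units_eq_one_or s with rfl | rfl
    · left
      rw [one_smul]
    · right
      rw [Units.neg_smul, one_smul]

lemma eq_of_units_smul_eq {s t : ℤˣ} {x : ℂ} (hx : x ≠ 0) (h : s • x = t • x) : s = t := by
  rw [Units.smul_def, Units.smul_def] at h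
  exact Units.ext (smul_left_injective ℤ hx h)

end Coordinates

section TypeI

variable {s₁₃ s₂₃ s₁₄ s₂₄ s₃₄ : ℤˣ} {l : Edge 4 → ℂ}

lemma mem_subspaceI : l ∈ subspaceI s₁₃ s₂₃ s₁₄ s₂₄ s₃₄ ↔
    len 0 1 l - s₁₃ • len 0 2 l + s₂₃ • len 1 2 l = 0 ∧
      len 0 1 l - s₁₄ • len 0 3 l + s₂₄ • len 1 3 l = 0 ∧
      s₁₃ • len 0 2 l - s₁₄ • len 0 3 l + s₃₄ • len 2 3 l = 0 := by
  simp [subspaceI, and_assoc]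

lemma bijective_starLengths_subspaceI :
    Function.Bijective ((starLengths 0).domRestrict (subspaceI s₁₃ s₂₃ s₁₄ s₂₄ s₃₄)) := by
  let f : (Edge 4 → ℂ) →ₗ[ℂ] (Fin 3 → ℂ) := LinearMap.pi ![len 0 1 - s₁₃ • len 0 2 + s₂₃ • len 1 2,
    len 0 1 - s₁₄ • len 0 3 + s₂₄ • len 1 3, s₁₃ • len 0 2 - s₁₄ • len 0 3 + s₃₄ • len 2 3]
  have hker : LinearMap.ker f = subspaceI s₁₃ s₂₃ s₁₄ s₂₄ s₃₄ := by
    ext l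
    simp [f, mem_subspaceI, funext_iff, Fin.forall_fin_succ]
  rw [← hker]
  refine bijective_domRestrict_ker (by simp [card_edge_four]) fun l hl hstar => ?_
  refine eq_zero_of_starLengths_of_faceLengths hstar ?_
  rw [starLengths_eq_zero_iff] at hstar
  rw [← LinearMap.mem_ker, hker, mem_subspaceI] at hl
  simp only [hstar, smul_zero, sub_zero, zero_add, smul_eq_zero_iff_eq] at hl
  rw [faceLengths_eq_zero_iff]
  simp [Fin.forall_fin_succ, hl, len_self, len_comm 2 1, len_comm 3 1, len_comm 3 2]

lemma units_eq_of_sub_add_eq_zero {s s' t t' : ℤˣ} {x y z : ℂ} (hx : x ≠ 0) (hy : y ≠ 0)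
    (hz : z ≠ 0) (h : x - s • y + t • z = 0) (h' : x - s' • y + t' • z = 0) :
    s = s' ∧ t = t' := by
  have hs : s = s' := by
    by_contra! hs
    rcases eq_or_ne t t' with rfl | ht
    · exact hs (eq_of_units_smul_eq hy (by linear_combination h' - h))
    · rw [Int.units_ne_iff_eq_neg] at hs ht
      rw [hs, ht, Units.neg_smul, Units.neg_smul] at h
      exact hx (by linear_combination (h + h') / 2)
  subst hs
  exact ⟨rfl, eq_of_units_smul_eq hz (by linear_combination h - h')⟩

lemma exists_mem_subspaceI_forall_len_ne_zero (s₁₃ s₂₃ s₁₄ s₂₄ s₃₄ : ℤˣ) :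
    ∃ l ∈ subspaceI s₁₃ s₂₃ s₁₄ s₂₄ s₃₄, ∀ i j, i ≠ j → len i j l ≠ 0 := by
  obtain ⟨⟨l, hl⟩, hstar⟩ := (bijective_starLengths_subspaceI (s₁₃ := s₁₃) (s₂₃ := s₂₃)
    (s₁₄ := s₁₄) (s₂₄ := s₂₄) (s₃₄ := s₃₄)).surjective ![1, s₁₃ • 2, s₁₄ • 3]
  have h₀₁ : len 0 1 l = 1 := congrFun hstar 0
  have h₀₂ : len 0 2 l = s₁₃ • 2 := congrFun hstar 1
  have h₀₃ : len 0 3 l = s₁₄ • 3 := congrFun hstar 2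
  have hmem := mem_subspaceI.1 hl
  simp only [h₀₁, h₀₂, h₀₃, smul_smul, Int.units_mul_self, one_smul] at hmem
  have hne : len 0 1 l ≠ 0 ∧ len 0 2 l ≠ 0 ∧ len 0 3 l ≠ 0 ∧ len 1 2 l ≠ 0 ∧ len 1 3 l ≠ 0 ∧
      len 2 3 l ≠ 0 := by
    refine ⟨by simp [h₀₁], by simp [h₀₂, smul_eq_zero_iff_eq], by simp [h₀₃, smul_eq_zero_iff_eq],
      fun h => ?_, fun h => ?_, fun h => ?_⟩ <;> norm_num [h] at hmem
  refine ⟨l, hl, ?_⟩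
  simp [Fin.forall_fin_succ, hne, len_comm 1 0, len_comm 2 0, len_comm 3 0, len_comm 2 1,
    len_comm 3 1, len_comm 3 2]

theorem ncard_typeI : typeI.ncard = 32 := by
  let F (s : ℤˣ × ℤˣ × ℤˣ × ℤˣ × ℤˣ) : Submodule ℂ (Edge 4 → ℂ) :=
    subspaceI s.1 s.2.1 s.2.2.1 s.2.2.2.1 s.2.2.2.2
  have hF : Function.Injective F := by
    rintro ⟨s₁₃, s₂₃, s₁₄, s₂₄, s₃₄⟩ ⟨t₁₃, t₂₃, t₁₄, t₂₄, t₃₄⟩ h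
    obtain ⟨l, hs, hl⟩ := exists_mem_subspaceI_forall_len_ne_zero s₁₃ s₂₃ s₁₄ s₂₄ s₃₄
    have ht : l ∈ subspaceI t₁₃ t₂₃ t₁₄ t₂₄ t₃₄ := h.le hs
    rw [mem_subspaceI] at hs ht
    have hl₀₁ := hl 0 1 (by decide)
    obtain ⟨rfl, rfl⟩ := units_eq_of_sub_add_eq_zero hl₀₁ (hl 0 2 (by decide))
      (hl 1 2 (by decide)) hs.1 ht.1
    obtain ⟨rfl, rfl⟩ := units_eq_of_sub_add_eq_zero hl₀₁ (hl 0 3 (by decide))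
      (hl 1 3 (by decide)) hs.2.1 ht.2.1
    obtain rfl := eq_of_units_smul_eq (hl 2 3 (by decide))
      (add_left_cancel (hs.2.2.trans ht.2.2.symm))
    rfl
  have hrange : typeI = Set.range F := by
    ext W
    simp [typeI, F, eq_comm]
  rw [hrange, Set.ncard_range_of_injective hF]
  simp

lemma mem_iUnion_typeI_iff_sq : l ∈ ⋃ W ∈ typeI, (W : Set (Edge 4 → ℂ)) ↔
    ∃ s₁₃ s₁₄ : ℤˣ, len 1 2 l ^ 2 = (s₁₃ • len 0 2 l - len 0 1 l) ^ 2 ∧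
      len 1 3 l ^ 2 = (s₁₄ • len 0 3 l - len 0 1 l) ^ 2 ∧
      len 2 3 l ^ 2 = (s₁₄ • len 0 3 l - s₁₃ • len 0 2 l) ^ 2 := by
  have hmem : l ∈ ⋃ W ∈ typeI, (W : Set (Edge 4 → ℂ)) ↔
      ∃ s₁₃ s₂₃ s₁₄ s₂₄ s₃₄, l ∈ subspaceI s₁₃ s₂₃ s₁₄ s₂₄ s₃₄ := by
    simp only [typeI, Set.mem_iUnion, Set.mem_ofPred_eq, SetLike.mem_coe]
    grind
  have hsign (x y z : ℂ) : z ^ 2 = (y - x) ^ 2 ↔ ∃ s : ℤˣ, x - y + s • z = 0 := by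
    simp only [eq_comm (a := z ^ 2), sq_eq_sq_iff_exists_units_smul, ← neg_sub y x,
      neg_add_eq_zero]
  simp only [hmem, mem_subspaceI, hsign]
  grind

theorem mem_iUnion_typeI :
    l ∈ ⋃ W ∈ typeI, (W : Set (Edge 4 → ℂ)) ↔ l ∈ unsquaredMeasurementVariety 1 4 := by
  rw [mem_iUnion_typeI_iff_sq, mem_unsquaredMeasurementVariety]
  simp only [sqLenMatrix, of_apply, Fin.sum_univ_one]
  constructor
  · rintro ⟨s₁₃, s₁₄, h₁₂, h₁₃, h₂₃⟩
    refine ⟨fun i _ => ![0, len 0 1 l, s₁₃ • len 0 2 l, s₁₄ • len 0 3 l] i, ?_⟩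
    simp [Fin.forall_fin_succ, len_self, len_comm 1 0, len_comm 2 0, len_comm 3 0, len_comm 2 1,
      len_comm 3 1, len_comm 3 2, h₁₂, h₁₃, h₂₃, smul_pow, sub_sq_comm]
  · rintro ⟨p, hp⟩
    have hsign (i : Fin 4) : ∃ s : ℤˣ, p i 0 - p 0 0 = s • len 0 i l := by
      rw [← sq_eq_sq_iff_exists_units_smul, hp, sub_sq_comm]
    choose s hs using hsign
    have hsq (i j : Fin 4) : len i j l ^ 2 = (s j • len 0 j l - s i • len 0 i l) ^ 2 := by
      rw [hp, ← hs, ← hs]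
      ring
    have hmul (t : ℤˣ) (x : ℂ) : (t • x) ^ 2 = x ^ 2 := by
      rw [smul_pow, Int.units_sq, one_smul]
    refine ⟨s 1 * s 2, s 1 * s 3, ?_, ?_, ?_⟩
    · rw [hsq, ← hmul (s 1), smul_sub, smul_smul, smul_smul, Int.units_mul_self, one_smul]
    · rw [hsq, ← hmul (s 1), smul_sub, smul_smul, smul_smul, Int.units_mul_self, one_smul]
    · rw [hsq, ← hmul (s 1), smul_sub, smul_smul, smul_smul]

end TypeI

section TypeII

variable {i j : Fin 4} {s : Fin 4 → ℤˣ} {l : Edge 4 → ℂ}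

lemma mem_subspaceII : l ∈ subspaceII i j s ↔ ∀ k, len i k l = s k • len j k l := by
  have hmem : l ∈ subspaceII i j s ↔
      len i j l = 0 ∧ ∀ k, k ≠ i → k ≠ j → len i k l = s k • len j k l := by
    simp [subspaceII, Submodule.mem_iInf, sub_eq_zero]
  rw [hmem]
  constructor
  · rintro ⟨hij, h⟩ k
    rcases eq_or_ne k i with rfl | hi
    · simp [len_self, len_comm j k, hij]
    rcases eq_or_ne k j with rfl | hj
    · simp [len_self, hij]
    exact h k hi hj
  · intro h
    exact ⟨by simpa [len_self] using h j, fun k _ _ => h k⟩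

lemma bijective_faceLengths_subspaceII (hij : i ≠ j) :
    Function.Bijective ((faceLengths i).domRestrict (subspaceII i j s)) := by
  let f : (Edge 4 → ℂ) →ₗ[ℂ] (Fin 3 → ℂ) :=
    LinearMap.pi fun t => len i (i.succAbove t) - s (i.succAbove t) • len j (i.succAbove t)
  have hker : LinearMap.ker f = subspaceII i j s := by
    ext l
    have hii : len i i l = s i • len j i l ↔ len i j l = 0 := by
      rw [len_self, LinearMap.zero_apply, eq_comm, smul_eq_zero_iff_eq, len_comm]
    have hj : (∀ t, len i (i.succAbove t) l = s (i.succAbove t) • len j (i.succAbove t) l) →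
        len i j l = 0 := by
      obtain ⟨t, rfl⟩ := Fin.exists_succAbove_eq hij.symm
      intro h
      simpa [len_self] using h t
    rw [mem_subspaceII, Fin.forall_iff_succAbove i, hii, and_iff_right_of_imp hj]
    simp [f, funext_iff, sub_eq_zero]
  rw [← hker]
  refine bijective_domRestrict_ker (by simp [card_edge_four, card_edge_three]) fun l hl hface => ?_
  refine eq_zero_of_starLengths_of_faceLengths (starLengths_eq_zero_iff.2 fun k => ?_) hface
  rw [faceLengths_eq_zero_iff] at hface
  rcases eq_or_ne k i with rfl | hk
  · rw [len_self, LinearMap.zero_apply]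
  · rw [← LinearMap.mem_ker, hker, mem_subspaceII] at hl
    rw [hl, hface j k hij.symm hk, smul_zero]

lemma exists_mem_subspaceII_eq_of_len_eq_zero (hij : i ≠ j) (s : Fin 4 → ℤˣ) :
    ∃ l ∈ subspaceII i j s, ∀ a b, a ≠ b → len a b l = 0 → s(a, b) = s(i, j) := by
  obtain ⟨⟨l, hl⟩, hface⟩ := (bijective_faceLengths_subspaceII (s := s) hij).surjective 1
  have hne {a b : Fin 4} (ha : a ≠ i) (hb : b ≠ i) (hab : a ≠ b) : len a b l ≠ 0 := by
    obtain ⟨t, rfl⟩ := Fin.exists_succAbove_eq ha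
    obtain ⟨u, rfl⟩ := Fin.exists_succAbove_eq hb
    rcases (i.succAbove_right_injective.ne_iff.1 hab).lt_or_gt with htu | hut
    · exact (congrFun hface ⟨(t, u), htu⟩).trans_ne one_ne_zero
    · rw [len_comm]
      exact (congrFun hface ⟨(u, t), hut⟩).trans_ne one_ne_zero
  have hstar {k : Fin 4} (hk : k ≠ i) (h : len i k l = 0) : k = j := by
    rw [mem_subspaceII.1 hl, smul_eq_zero_iff_eq] at h
    by_contra hkj
    exact hne hij.symm hk (Ne.symm hkj) h
  refine ⟨l, hl, fun a b hab h => ?_⟩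
  by_cases ha : a = i
  · subst ha
    rw [hstar hab.symm h]
  by_cases hb : b = i
  · subst hb
    rw [len_comm] at h
    rw [hstar hab h, Sym2.eq_swap]
  exact absurd h (hne ha hb hab)

theorem mem_iUnion_typeIIAt :
    l ∈ ⋃ W ∈ typeIIAt i j, (W : Set (Edge 4 → ℂ)) ↔ ∀ k, len i k l ^ 2 = len j k l ^ 2 := by
  simp only [sq_eq_sq_iff_exists_units_smul, Classical.skolem]
  simp [typeIIAt, ← mem_subspaceII]

theorem mem_iUnion_typeII : l ∈ ⋃ W ∈ typeII, (W : Set (Edge 4 → ℂ)) ↔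
    ∃ i j, i ≠ j ∧ ∀ k, len i k l ^ 2 = len j k l ^ 2 := by
  have hmem : l ∈ ⋃ W ∈ typeII, (W : Set (Edge 4 → ℂ)) ↔
      ∃ i j, i < j ∧ l ∈ ⋃ W ∈ typeIIAt i j, (W : Set (Edge 4 → ℂ)) := by
    simp only [typeII, Set.mem_iUnion, Set.mem_ofPred_eq]
    grind
  simp only [hmem, mem_iUnion_typeIIAt]
  constructor
  · rintro ⟨i, j, hij, h⟩
    exact ⟨i, j, hij.ne, h⟩
  · rintro ⟨i, j, hij, h⟩
    rcases hij.lt_or_gt with hij | hij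
    · exact ⟨i, j, hij, h⟩
    · exact ⟨j, i, hij, fun k => (h k).symm⟩

theorem ncard_typeIIAt (hij : i ≠ j) : (typeIIAt i j).ncard = 4 := by
  let F (s : {k // k ≠ i ∧ k ≠ j} → ℤˣ) : Submodule ℂ (Edge 4 → ℂ) :=
    subspaceII i j fun k => if hk : k ≠ i ∧ k ≠ j then s ⟨k, hk⟩ else 1
  have hF : Function.Injective F := by
    intro s t hst
    obtain ⟨l, hs, hl⟩ := exists_mem_subspaceII_eq_of_len_eq_zero hij
      fun k => if hk : k ≠ i ∧ k ≠ j then s ⟨k, hk⟩ else 1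
    have ht : l ∈ F t := hst.le hs
    ext k : 1
    have hjk : len j k l ≠ 0 := fun h => by simpa [hij.symm, k.2] using hl j k k.2.2.symm h
    refine eq_of_units_smul_eq hjk ?_
    simpa [k.2] using (mem_subspaceII.1 hs k).symm.trans (mem_subspaceII.1 ht k)
  have hrange : typeIIAt i j = Set.range F := by
    ext W
    constructor
    · rintro ⟨s, rfl⟩
      refine ⟨fun k => s k, congrArg (_ ⊓ ·) (iInf_congr fun k => iInf_congr fun hk => ?_)⟩
      rw [Set.mem_ofPred_eq] at hk
      simp only [dif_pos hk]
    · rintro ⟨s, rfl⟩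
      exact ⟨_, rfl⟩
  have hcard : Fintype.card {k // k ≠ i ∧ k ≠ j} = 2 := by
    clear hF hrange F
    revert i j
    decide
  rw [hrange, Set.ncard_range_of_injective hF, Nat.card_eq_fintype_card, Fintype.card_fun, hcard]
  rfl

theorem ncard_typeII : typeII.ncard = 24 := by
  have hU : typeII = ⋃ e : Edge 4, typeIIAt e.1.1 e.1.2 := by
    ext W
    simp [typeII]
  have hfin (e : Edge 4) : (typeIIAt e.1.1 e.1.2).Finite :=
    Set.finite_of_ncard_ne_zero (by rw [ncard_typeIIAt e.2.ne]; norm_num)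
  have hdisj : Pairwise (Function.onFun Disjoint fun e : Edge 4 => typeIIAt e.1.1 e.1.2) := by
    rintro ⟨⟨i, j⟩, hij⟩ ⟨⟨a, b⟩, hab⟩ hne
    rw [Function.onFun, Set.disjoint_left]
    rintro W ⟨s, rfl⟩ ⟨t, ht⟩
    obtain ⟨l, hl, hzero⟩ := exists_mem_subspaceII_eq_of_len_eq_zero hij.ne s
    rw [ht] at hl
    have hedge := hzero a b hab.ne hl.1
    grind
  rw [hU, Set.ncard_iUnion_of_finite hfin hdisj, finsum_eq_sum_of_fintype,
    Finset.sum_congr rfl fun e _ => ncard_typeIIAt e.2.ne, Finset.sum_const, Finset.card_univ,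
    card_edge_four, smul_eq_mul]

end TypeII

section TypeIII

variable {l : Edge 4 → ℂ}

theorem typeIII_eq_range : typeIII = Set.range fun h : Fin 4 => LinearMap.ker (faceLengths h) := by
  have hker (h : Fin 4) : LinearMap.ker (faceLengths h) =
      subspaceIII (h.succAbove 0) (h.succAbove 1) (h.succAbove 2) := by
    ext l
    simp [funext_iff, faceLengths, subspaceIII, Fin.forall_fin_succ, and_assoc]
  ext W
  simp only [hker]
  constructor
  · rintro ⟨i, j, k, hij, hjk, rfl⟩
    obtain ⟨h, rfl, rfl, rfl⟩ : ∃ h : Fin 4, h.succAbove 0 = i ∧ h.succAbove 1 = j ∧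
        h.succAbove 2 = k := by
      revert i j k
      decide
    exact ⟨h, rfl⟩
  · rintro ⟨h, rfl⟩
    exact ⟨_, _, _, h.strictMono_succAbove (by decide), h.strictMono_succAbove (by decide), rfl⟩

theorem mem_iUnion_typeIII : l ∈ ⋃ W ∈ typeIII, (W : Set (Edge 4 → ℂ)) ↔
    ∃ h, ∀ i j, i ≠ h → j ≠ h → len i j l = 0 := by
  simp [typeIII_eq_range, faceLengths_eq_zero_iff]

lemma bijective_starLengths_ker_faceLengths (h : Fin 4) :
    Function.Bijective ((starLengths h).domRestrict (LinearMap.ker (faceLengths h))) :=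
  bijective_domRestrict_ker (by simp [card_edge_four, card_edge_three])
    fun _ hface hstar => eq_zero_of_starLengths_of_faceLengths hstar hface

theorem ncard_typeIII : typeIII.ncard = 4 := by
  have hinj : Function.Injective fun h : Fin 4 => LinearMap.ker (faceLengths h) := by
    intro h h' heq
    by_contra hne
    obtain ⟨⟨l, hl⟩, hstar⟩ := (bijective_starLengths_ker_faceLengths h).surjective 1
    have hl' : faceLengths h' l = 0 := heq.le hl
    obtain ⟨x, hx, hx'⟩ : ∃ x, x ≠ h ∧ x ≠ h' := by
      clear heq hl hl' hstar
      revert h h'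
      decide
    obtain ⟨t, rfl⟩ := Fin.exists_succAbove_eq hx
    have ht : len h (h.succAbove t) l = 1 := congrFun hstar t
    rw [faceLengths_eq_zero_iff.1 hl' _ _ hne hx'] at ht
    exact zero_ne_one ht
  rw [typeIII_eq_range, Set.ncard_range_of_injective hinj, Nat.card_eq_fintype_card,
    Fintype.card_fin]

end TypeIII

section Types

theorem disjoint_typeI_typeII : Disjoint typeI typeII := by
  rw [Set.disjoint_left]
  rintro W ⟨s₁₃, s₂₃, s₁₄, s₂₄, s₃₄, rfl⟩ ⟨i, j, hij, t, ht⟩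
  obtain ⟨l, hl, hne⟩ := exists_mem_subspaceI_forall_len_ne_zero s₁₃ s₂₃ s₁₄ s₂₄ s₃₄
  rw [ht] at hl
  exact hne i j hij.ne hl.1

theorem disjoint_typeI_typeIII : Disjoint typeI typeIII := by
  rw [Set.disjoint_left]
  rintro W ⟨s₁₃, s₂₃, s₁₄, s₂₄, s₃₄, rfl⟩ ⟨i, j, k, hij, -, ht⟩
  obtain ⟨l, hl, hne⟩ := exists_mem_subspaceI_forall_len_ne_zero s₁₃ s₂₃ s₁₄ s₂₄ s₃₄
  rw [ht] at hl
  exact hne i j hij.ne hl.1.1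

theorem disjoint_typeII_typeIII : Disjoint typeII typeIII := by
  rw [Set.disjoint_left]
  rintro W ⟨i, j, hij, s, rfl⟩ ⟨a, b, c, hab, hbc, ht⟩
  obtain ⟨l, hl, hzero⟩ := exists_mem_subspaceII_eq_of_len_eq_zero hij.ne s
  rw [ht] at hl
  have hab_eq := hzero a b hab.ne hl.1.1
  have hac_eq := hzero a c (hab.trans hbc).ne hl.1.2
  exact hbc.ne (Sym2.congr_right.1 (hab_eq.trans hac_eq.symm))

theorem ncard_types : (typeI ∪ typeII ∪ typeIII).ncard = 60 := by
  have hI : typeI.Finite := Set.finite_of_ncard_ne_zero (by simp [ncard_typeI])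
  have hII : typeII.Finite := Set.finite_of_ncard_ne_zero (by simp [ncard_typeII])
  have hIII : typeIII.Finite := Set.finite_of_ncard_ne_zero (by simp [ncard_typeIII])
  rw [Set.ncard_union_eq (disjoint_typeI_typeIII.union_left disjoint_typeII_typeIII)
    (hI.union hII) hIII, Set.ncard_union_eq disjoint_typeI_typeII hI hII, ncard_typeI,
    ncard_typeII, ncard_typeIII]

theorem finrank_eq_three_of_mem_types {W : Submodule ℂ (Edge 4 → ℂ)}
    (hW : W ∈ typeI ∪ typeII ∪ typeIII) : Module.finrank ℂ W = 3 := by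
  rcases hW with (⟨_, _, _, _, _, rfl⟩ | ⟨i, j, hij, s, rfl⟩) | hW
  · simpa using (LinearEquiv.ofBijective _ bijective_starLengths_subspaceI).finrank_eq
  · simpa [card_edge_three] using
      (LinearEquiv.ofBijective _ (bijective_faceLengths_subspaceII hij.ne)).finrank_eq
  · rw [typeIII_eq_range] at hW
    obtain ⟨h, rfl⟩ := hW
    simpa using (LinearEquiv.ofBijective _ (bijective_starLengths_ker_faceLengths h)).finrank_eq

theorem singularLocus_unsquaredMeasurementVariety_two_four :
    singularLocus (unsquaredMeasurementVariety 2 4) =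
      ⋃ W ∈ typeI ∪ typeII ∪ typeIII, (W : Set (Edge 4 → ℂ)) := by
  have hL : unsquaredMeasurementVariety 2 4 = {l | eval l (cayleyMengerPoly 3) = 0} :=
    Set.ext fun l => mem_unsquaredMeasurementVariety_iff_eval_cayleyMengerPoly
  rw [hL, singularLocus_hypersurface irreducible_cayleyMengerPoly_three, Set.biUnion_union,
    Set.biUnion_union]
  ext l
  rw [Set.mem_union, Set.mem_union, mem_iUnion_typeI, mem_iUnion_typeII, mem_iUnion_typeIII,
    or_assoc, ← exists_isAffineDependency_len_mul_eq_zero_iff, ← cayleyMengerPoly_critical_iff]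
  rfl

end Types

theorem mainTheorem5 :
    -- the singular locus is the union of 60 three-dimensional subspaces
    singularLocus (unsquaredMeasurementVariety 2 4)
        = (⋃ W ∈ typeI ∪ typeII ∪ typeIII, (W : Set (Edge 4 → ℂ))) ∧
      (typeI ∪ typeII ∪ typeIII).ncard = 60 ∧
      (∀ W ∈ typeI ∪ typeII ∪ typeIII, Module.finrank ℂ W = 3) ∧
      -- the three types partition these subspaces
      Disjoint typeI typeII ∧ Disjoint typeI typeIII ∧ Disjoint typeII typeIII ∧
      -- type I
      typeI.ncard = 32 ∧
      (⋃ W ∈ typeI, (W : Set (Edge 4 → ℂ))) = unsquaredMeasurementVariety 1 4 ∧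
      -- type II
      typeII.ncard = 24 ∧
      (∀ i j : Fin 4, i < j →
        (typeIIAt i j).ncard = 4 ∧
        (⋃ W ∈ typeIIAt i j, (W : Set (Edge 4 → ℂ)))
          = {l | ∃ p : Fin 4 → Fin 2 → ℂ, p i = p j ∧ squaringMap l = sqLengths p}) ∧
      -- type III
      typeIII.ncard = 4 := by
  refine ⟨singularLocus_unsquaredMeasurementVariety_two_four, ncard_types,
    fun _ => finrank_eq_three_of_mem_types, disjoint_typeI_typeII, disjoint_typeI_typeIII,
    disjoint_typeII_typeIII, ncard_typeI, Set.ext fun _ => mem_iUnion_typeI, ncard_typeII,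
    fun i j hij => ⟨ncard_typeIIAt hij.ne, Set.ext fun l => ?_⟩, ncard_typeIII⟩
  rw [mem_iUnion_typeIIAt]
  exact (exists_collapsed_squaringMap_eq_sqLengths_iff hij.ne).symm
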